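/- \textbf{Theorem (Noether's Theorem).} Let $Q$ be an $n$-dimensional smooth manifold and let $T^1_kQ = TQ\oplus\cdots\oplus TQ$ ($k$ copies), with projection $\tau\colon T^1_kQ\to Q$ and induced local coordinates $(q^i, v^i_\alpha)$. Let $J^\alpha=\frac{\partial}{\partial v^i_\alpha}\otimes dq^i$, $1\le\alpha\le k$, be the canonical $k$-tangent structure and $\mathbb{C}=v^i_\alpha\frac{\partial}{\partial v^i_\alpha}$ the Liouville vector field. Let $L\colon T^1_kQ\to\mathbb{R}$ be a Lagrangian, i.e. a smooth function; put $E_L=\mathbb{C}(L)-L$, $\theta_L^\alpha = dL\circ J^\alpha$ and $\omega_L^\alpha=-d\theta_L^\alpha$. Let $X$ be a Cartan symmetry of $L$, i.e. a smooth vector field on $T^1_kQ$ with $\mathcal{L}_X\omega_L^\alpha=0$ for all $\alpha\in\{1,\dots,k\}$ and $X(E_L)=0$. Then every point of $T^1_kQ$ has an open neighbourhood $W$ on which there are smooth functions $g^1,\dots,g^k$ with $$\mathcal{L}_X\theta_L^\alpha = dg^\alpha\quad\text{on } W,\qquad \alpha\in\{1,\dots,k\}.$$ Moreover, for every open set $W\subseteq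 T^1_kQ$ and all smooth functions $g^\alpha$ on $W$ with this property, the functions $f^\alpha=\theta_L^\alpha(X)-g^\alpha$ on $W$ have the following properties. (a) They form a conservation law on $W$ for the Euler--Lagrange equations $\frac{\partial}{\partial t^\alpha}\left(\frac{\partial L}{\partial v^i_\alpha}\right)-\frac{\partial L}{\partial q^i}=0$: the $f^\alpha$ are smooth, and for every smooth solution $\phi\colon U\to Q$ of these equations on an open set $U\subseteq\mathbb{R}^k$ whose first prolongation $\phi^{(1)}=\left(\phi,\frac{\partial\phi}{\partial t^1},\dots,\frac{\partial\phi}{\partial t^k}\right)$ takes values in $W$, $$\sum_{\alpha=1}^k\frac{\partial (f^\alpha\circ\phi^{(1)})}{\partial t^\alpha}=0\quad\text{on } U.$$ (b) $i_X\omega_L^\alpha=df^\alpha$ on $W$ for all $\alpha$. (c) $\sum_\alpha\xi_\alpha(f^\alpha)=0$ on $W$ for all smooth vector fields $\xi_1,\dots,\xi_k$ on $T^1_kQ$ that satisfy $d\tau(\xi_\alpha(q,v))=v_\alpha$ for all $\alpha$ and all $(q,v)=(q,v_1,\dots,v_k)\in T^1_kQ$, and $\sum_\alpha i_{\xi_\alpha}\omega_L^\alpha=dE_L$.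 -/

import Mathlib

open Bundle Set Topology
open scoped Manifold ContDiff

namespace KSymplectic

noncomputable section

/-! ## Differential forms on a manifold without boundary

The model `I` below is meant to be boundaryless, so that inverse charts are defined on open subsets
of the model vector space `E`. -/

section Forms

variable {E : Type*} [NormedAddCommGroup E] [NormedSpace ℝ E]
  {H : Type*} [TopologicalSpace H] (I : ModelWithCorners ℝ E H)
  (M : Type*) [TopologicalSpace M] [ChartedSpace H M]

/-- A (not necessarily smooth) differential `m`-form on `M`. -/
abbrev DForm (m : ℕ) : Type _ := Π x : M, TangentSpace I x [⋀^Fin m]→L[ℝ] ℝ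

variable {I M}

/-- The expression of the form `η` in the chart around `x`: its pullback by the inverse chart. -/
def DForm.inChart {m : ℕ} (η : DForm I M m) (x : M) : E → E [⋀^Fin m]→L[ℝ] ℝ := fun y =>
  (η ((extChartAt I x).symm y)).compContinuousLinearMap
    (mfderiv 𝓘(ℝ, E) I (extChartAt I x).symm y)

/-- The expression of the vector field `X` in the chart around `x`. -/
def fieldInChart (X : Π x : M, TangentSpace I x) (x : M) : E → E :=
  VectorField.mpullback 𝓘(ℝ, E) I (extChartAt I x).symm X

/-- The exterior derivative `dη`, computed at every point in the chart around that point. -/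
def extD {m : ℕ} (η : DForm I M m) : DForm I M (m + 1) := fun x =>
  (extDeriv (DForm.inChart η x) (extChartAt I x x)).compContinuousLinearMap
    (mfderiv I 𝓘(ℝ, E) (extChartAt I x) x)

/-- The Lie derivative `(L_X η)_x (v₁, …, v_m)` of a form along a vector field: in coordinates,
`(L_X η)(v₁, …, v_m) = (D η)(X)(v₁, …, v_m) + ∑ⱼ η(v₁, …, (D X)(vⱼ), …, v_m)`. -/
def lieDeriv {m : ℕ} (X : Π x : M, TangentSpace I x) (η : DForm I M m) (x : M)
    (v : Fin m → TangentSpace I x) : ℝ :=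
  let y : E := extChartAt I x x
  let w : Fin m → E := fun j => mfderiv I 𝓘(ℝ, E) (extChartAt I x) x (v j)
  fderiv ℝ (DForm.inChart η x) y (fieldInChart X x y) w +
    ∑ j, DForm.inChart η x y (Function.update w j (fderiv ℝ (fieldInChart X x) y (w j)))

end Forms

/-! ## The tangent bundle of `k¹`-velocities -/

/-- The coordinate space `ℝⁿ`. -/
abbrev Euc (n : ℕ) : Type := EuclideanSpace ℝ (Fin n)

/-- The endomorphism `(v₁, …, v_k) ↦ (A v₁, …, A v_k)` depends continuously and linearly on `A`. -/
def diagL (n k : ℕ) : (Euc n →L[ℝ] Euc n) →L[ℝ] ((Fin k → Euc n) →L[ℝ] (Fin k → Euc n)) :=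
  LinearMap.toContinuousLinearMap
    { toFun := fun A => ContinuousLinearMap.piMap fun _ => A
      map_add' := fun _ _ => by ext; simp
      map_smul' := fun _ _ => by ext; simp }

@[simp]
theorem diagL_apply {n k : ℕ} (A : Euc n →L[ℝ] Euc n) (v : Fin k → Euc n) (α : Fin k) :
    diagL n k A v α = A (v α) := rfl

section Velocities

variable (n k : ℕ) (Q : Type*) [TopologicalSpace Q] [ChartedSpace (Euc n) Q]

section Bundle

variable [IsManifold (𝓡 n) 1 Q]

/-- The Whitney sum `TQ ⊕ ⋯ ⊕ TQ` of `k` copies of the tangent bundle: the coordinate changes are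
those of `TQ`, applied in every component. -/
def velCore : VectorBundleCore ℝ Q (Fin k → Euc n) (atlas (Euc n) Q) where
  baseSet := (tangentBundleCore (𝓡 n) Q).baseSet
  isOpen_baseSet := (tangentBundleCore (𝓡 n) Q).isOpen_baseSet
  indexAt := (tangentBundleCore (𝓡 n) Q).indexAt
  mem_baseSet_at := (tangentBundleCore (𝓡 n) Q).mem_baseSet_at
  coordChange i j q := diagL n k ((tangentBundleCore (𝓡 n) Q).coordChange i j q)
  coordChange_self i q hq v := by
    funext α
    exact (tangentBundleCore (𝓡 n) Q).coordChange_self i q hq (v α)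
  continuousOn_coordChange i j :=
    (diagL n k).continuous.comp_continuousOn
      ((tangentBundleCore (𝓡 n) Q).continuousOn_coordChange i j)
  coordChange_comp i j l q hq v := by
    funext α
    exact (tangentBundleCore (𝓡 n) Q).coordChange_comp i j l q hq (v α)

/-- The tangent bundle of `k¹`-velocities `T¹ₖQ`. A point `u` of it consists of its base point
`u.proj : Q` and of the `k` tangent vectors `vel u α` at that point. -/
abbrev T1 : Type _ := TotalSpace (Fin k → Euc n) (velCore n k Q).Fiber

end Bundle

instance velCore_isContMDiff [IsManifold (𝓡 n) ∞ Q] :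
    (velCore n k Q).IsContMDiff (𝓡 n) ∞ := by
  have : IsManifold (𝓡 n) (∞ + 1) Q := ‹IsManifold (𝓡 n) ∞ Q›
  have h : (tangentBundleCore (𝓡 n) Q).IsContMDiff (𝓡 n) ∞ := tangentBundleCore.isContMDiff
  exact ⟨fun i j => (diagL n k).contMDiff.comp_contMDiffOn (h.contMDiffOn_coordChange i j)⟩

/-- The model with corners of the manifold `T¹ₖQ`, with model vector space `ℝⁿ × (ℝⁿ)ᵏ`. -/
abbrev velModel : ModelWithCorners ℝ (Euc n × (Fin k → Euc n))
    (ModelProd (Euc n) (Fin k → Euc n)) :=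
  (𝓡 n).prod 𝓘(ℝ, Fin k → Euc n)

end Velocities

section Lagrangian

variable {n k : ℕ} {Q : Type*} [TopologicalSpace Q] [ChartedSpace (Euc n) Q]
  [IsManifold (𝓡 n) ∞ Q]

/-- The point `(q, v₁, …, v_k)` of `T¹ₖQ`. -/
def mkVel (q : Q) (v : Fin k → TangentSpace (𝓡 n) q) : T1 n k Q := ⟨q, v⟩

/-- The `α`-th velocity `v_α` of the point `u = (q, v₁, …, v_k)`. -/
def vel (u : T1 n k Q) (α : Fin k) : TangentSpace (𝓡 n) u.proj :=
  (show Fin k → Euc n from u.snd) α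

/-- The tangent spaces of `T¹ₖQ`. -/
abbrev TVel (u : T1 n k Q) : Type := TangentSpace (velModel n k) u

/-- A vector field on `T¹ₖQ` is smooth. -/
def IsSmoothField (X : Π u : T1 n k Q, TVel u) : Prop :=
  ContMDiff (velModel n k) (velModel n k).tangent ∞
    (fun u => (⟨u, X u⟩ : TangentBundle (velModel n k) (T1 n k Q)))

/-- The differential of the projection `τ : T¹ₖQ → Q` at `u`. -/
def dProj (u : T1 n k Q) : TVel u →L[ℝ] TangentSpace (𝓡 n) u.proj :=
  mfderiv (velModel n k) (𝓡 n) (fun p : T1 n k Q => p.proj) u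

/-- The vertical lift `d/ds|₀ (q, v₁ + s w₁, …, v_k + s w_k)` at `u = (q, v₁, …, v_k)`: the
differential at `(v₁, …, v_k)` of the inclusion of the fibre over `q`. -/
def vertLift (u : T1 n k Q) : (Fin k → TangentSpace (𝓡 n) u.proj) →L[ℝ] TVel u :=
  mfderiv 𝓘(ℝ, Fin k → Euc n) (velModel n k)
    (fun v : Fin k → Euc n => (mkVel u.proj v : T1 n k Q)) (vel u)

/-- The canonical `k`-tangent structure: `J^α` sends a tangent vector `w` at `u` to the vertical
lift of `dτ(w)` in the `α`-th copy of `TQ`. Locally, `J^α = ∂/∂v^i_α ⊗ dq^i`. -/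
def tangentStructure (α : Fin k) (u : T1 n k Q) : TVel u →L[ℝ] TVel u :=
  (vertLift u).comp
    ((ContinuousLinearMap.single ℝ (fun _ : Fin k => TangentSpace (𝓡 n) u.proj) α).comp (dProj u))

/-- The Liouville vector field, the generator of the flow `(q, v) ↦ (q, eˢ v)`, that is, the
vertical lift of `v` at `(q, v)`. Locally, it is `v^i_α ∂/∂v^i_α`. -/
def liouville (u : T1 n k Q) : TVel u := vertLift u (vel u)

/-- The differential of a function on `T¹ₖQ`. -/
def dFun (f : T1 n k Q → ℝ) (u : T1 n k Q) : TVel u →L[ℝ] ℝ :=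
  mfderiv (velModel n k) 𝓘(ℝ, ℝ) f u

/-- The energy `E_L = ℂ(L) - L`. -/
def energy (L : T1 n k Q → ℝ) (u : T1 n k Q) : ℝ := dFun L u (liouville u) - L u

/-- The Poincaré–Cartan `1`-forms `θ_L^α = dL ∘ J^α`. -/
def theta (L : T1 n k Q → ℝ) (α : Fin k) : DForm (velModel n k) (T1 n k Q) 1 := fun u =>
  ContinuousAlternatingMap.ofSubsingleton ℝ (TVel u) ℝ (0 : Fin 1)
    ((dFun L u).comp (tangentStructure α u))

/-- The Poincaré–Cartan `2`-forms `ω_L^α = - d θ_L^α`. -/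
def omega (L : T1 n k Q → ℝ) (α : Fin k) : DForm (velModel n k) (T1 n k Q) 2 :=
  - extD (theta L α)

/-- `X` is a Cartan symmetry of `L`: a smooth vector field on `T¹ₖQ` with `L_X ω_L^α = 0` for all
`α`, and `X(E_L) = 0`. -/
structure IsCartanSymmetry (L : T1 n k Q → ℝ) (X : Π u : T1 n k Q, TVel u) : Prop where
  smooth : IsSmoothField X
  lieDeriv_omega : ∀ (α : Fin k) (u : T1 n k Q) (v : Fin 2 → TVel u),
    lieDeriv X (omega L α) u v = 0
  energy : ∀ u : T1 n k Q, dFun (energy L) u (X u) = 0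

/-! ### Euler–Lagrange field equations -/

/-- The `α`-th vector of the standard basis of `ℝᵐ`. -/
def stdVec {m : ℕ} (α : Fin m) : Euc m := EuclideanSpace.single α 1

/-- The first prolongation `φ⁽¹⁾(t) = (φ(t), dφ_t(∂/∂t¹), …, dφ_t(∂/∂tᵏ))` of a map
`φ : ℝᵏ → Q`. -/
def prolong (φ : Euc k → Q) (t : Euc k) : T1 n k Q :=
  mkVel (φ t) fun α => mfderiv (𝓡 k) (𝓡 n) φ t (stdVec α)

/-- The expression of `L` in the coordinates `(q^i, v^i_α)` of `T¹ₖQ` induced by a chart `c` of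
`Q`. -/
def coordLag (L : T1 n k Q → ℝ) (c : OpenPartialHomeomorph Q (Euc n)) :
    Euc n × (Fin k → Euc n) → ℝ := fun p =>
  L (mkVel (c.symm p.1) fun α => mfderiv (𝓡 n) (𝓡 n) c.symm p.1 (p.2 α))

/-- The expression of the first prolongation `φ⁽¹⁾` in the coordinates induced by a chart `c`:
`(φ^i(t), ∂φ^i/∂t^α(t))`. -/
def coordProlong (φ : Euc k → Q) (c : OpenPartialHomeomorph Q (Euc n)) (t : Euc k) :
    Euc n × (Fin k → Euc n) :=
  (c (φ t), fun α => fderiv ℝ (fun s => c (φ s)) t (stdVec α))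

/-- `φ` solves the Euler–Lagrange equations `∂/∂t^α (∂L/∂v^i_α) = ∂L/∂q^i` on the open set `U`:
it is smooth there and satisfies them at every point of `U`, in every chart around its image. -/
structure IsEulerLagrangeSolution (L : T1 n k Q → ℝ) (U : Set (Euc k)) (φ : Euc k → Q) :
    Prop where
  isOpen : IsOpen U
  smooth : ContMDiffOn (𝓡 k) (𝓡 n) ∞ φ U
  equation : ∀ t ∈ U, ∀ c ∈ atlas (Euc n) Q, φ t ∈ c.source → ∀ i : Fin n,
    ∑ α : Fin k,
      fderiv ℝ (fun s => fderiv ℝ (coordLag L c) (coordProlong φ c s)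
        (0, Pi.single α (stdVec i))) t (stdVec α) =
      fderiv ℝ (coordLag L c) (coordProlong φ c t) (stdVec i, 0)

/-- The functions `f^α`, defined and smooth on the open set `W ⊆ T¹ₖQ`, form a conservation law for
the Euler–Lagrange equations of `L`: the divergence of `f ∘ φ⁽¹⁾` vanishes for every solution `φ`
with `φ⁽¹⁾(U) ⊆ W`. -/
structure IsConservationLawOn (L : T1 n k Q → ℝ) (W : Set (T1 n k Q))
    (f : Fin k → T1 n k Q → ℝ) : Prop where
  smooth : ∀ α, ContMDiffOn (velModel n k) 𝓘(ℝ, ℝ) ∞ (f α) W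
  divergence : ∀ (U : Set (Euc k)) (φ : Euc k → Q), IsEulerLagrangeSolution L U φ →
    (∀ t ∈ U, prolong φ t ∈ W) →
    ∀ t ∈ U, ∑ α : Fin k, fderiv ℝ (fun s => f α (prolong φ s)) t (stdVec α) = 0

/-- The smooth functions `g^α`, defined on the open set `W`, satisfy `L_X θ_L^α = dg^α` on `W`. -/
structure IsLiePotentialOn (L : T1 n k Q → ℝ) (X : Π u : T1 n k Q, TVel u) (W : Set (T1 n k Q))
    (g : Fin k → T1 n k Q → ℝ) : Prop where
  isOpen : IsOpen W
  smooth : ∀ α, ContMDiffOn (velModel n k) 𝓘(ℝ, ℝ) ∞ (g α) W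
  lieDeriv_theta : ∀ α, ∀ u ∈ W, ∀ v : TVel u,
    lieDeriv X (theta L α) u (fun _ => v) = dFun (g α) u v

/-- A second-order partial differential equation field (`SOPDE`) in the solution set of the
geometric Euler–Lagrange equation: smooth vector fields `ξ_α` on `T¹ₖQ` with
`dτ(ξ_α(q, v)) = v_α` and `∑_α i_{ξ_α} ω_L^α = dE_L`. -/
structure IsLagrangianSopde (L : T1 n k Q → ℝ) (ξ : Fin k → Π u : T1 n k Q, TVel u) : Prop where
  smooth : ∀ α, IsSmoothField (ξ α)
  sopde : ∀ α u, dProj u (ξ α u) = vel u α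
  equation : ∀ (u : T1 n k Q) (w : TVel u),
    ∑ α, omega L α u ![ξ α u, w] = dFun (energy L) u w

end Lagrangian

end

end KSymplectic

open KSymplectic

namespace KSymplectic

section NormedSpaceForms

variable {E : Type*} [NormedAddCommGroup E] [NormedSpace ℝ E]

theorem fderiv_form_apply_const {m : ℕ} {η : E → E [⋀^Fin m]→L[ℝ] ℝ} {y : E}
    (hη : DifferentiableAt ℝ η y) (v : Fin m → E) (w : E) :
    fderiv ℝ (fun z => η z v) y w = fderiv ℝ η y w v := by
  have h := (ContinuousAlternatingMap.apply ℝ E ℝ v).hasFDerivAt.comp y hη.hasFDerivAt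
  have h2 : fderiv ℝ (fun z => η z v) y = _ := h.fderiv
  rw [h2]; rfl

theorem extDeriv_oneForm_apply {η : E → E [⋀^Fin 1]→L[ℝ] ℝ} {y : E} (v : Fin 2 → E) :
    extDeriv η y v = fderiv ℝ η y (v 0) (fun _ => v 1) - fderiv ℝ η y (v 1) (fun _ => v 0) := by
  have h0 : Fin.removeNth 0 v = fun _ => v 1 := by
    funext i; fin_cases i; rfl
  have h1 : Fin.removeNth 1 v = fun _ => v 0 := by
    funext i; fin_cases i; rfl
  rw [extDeriv, ContinuousAlternatingMap.alternatizeUncurryFin_apply, Fin.sum_univ_two, h0, h1]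
  simp [sub_eq_add_neg]

theorem fderiv_form_contract {η : E → E [⋀^Fin 1]→L[ℝ] ℝ} {X : E → E} {y : E}
    (hη : DifferentiableAt ℝ η y) (hX : DifferentiableAt ℝ X y) (v : E) :
    fderiv ℝ (fun z => η z (fun _ => X z)) y v =
      fderiv ℝ η y v (fun _ => X y) + η y (fun _ => fderiv ℝ X y v) := by
  rw [fderiv_continuousAlternatingMap_apply_apply hη (fun _ => hX)]
  simp only [Fin.sum_univ_one]
  congr 2
  funext i
  rw [Subsingleton.elim i 0]
  simp

/-- Cartan's formula for `1`-forms on a normed space. -/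
theorem cartan_formula_oneForm {η : E → E [⋀^Fin 1]→L[ℝ] ℝ} {X : E → E} {y : E}
    (hη : DifferentiableAt ℝ η y) (hX : DifferentiableAt ℝ X y) (v : E) :
    fderiv ℝ η y (X y) (fun _ => v) + η y (fun _ => fderiv ℝ X y v) =
      extDeriv η y ![X y, v] + fderiv ℝ (fun z => η z (fun _ => X z)) y v := by
  rw [extDeriv_oneForm_apply, fderiv_form_contract hη hX]
  simp only [Matrix.cons_val_zero, Matrix.cons_val_one]
  ring

theorem fderiv_curryLeft_apply_const {Ω : E → E [⋀^Fin 2]→L[ℝ] ℝ} {X : E → E} {y : E}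
    (hΩ : DifferentiableAt ℝ Ω y) (hX : DifferentiableAt ℝ X y) (v w : E) :
    fderiv ℝ (fun z => (Ω z).curryLeft (X z)) y v (fun _ => w) =
      fderiv ℝ Ω y v ![X y, w] + Ω y ![fderiv ℝ X y v, w] := by
  let C := (ContinuousAlternatingMap.curryLeftLI (𝕜 := ℝ) (E := E) (F := ℝ)
    (n := 1)).toContinuousLinearMap
  have h0 := HasFDerivAt.comp (g := C) (g' := C) y C.hasFDerivAt hΩ.hasFDerivAt
  have h1 : HasFDerivAt (fun z => (Ω z).curryLeft) _ y := h0
  have hv : ∀ a : E, Matrix.vecCons a (fun _ : Fin 1 => w) = ![a, w] := fun a => by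
    congr 1; funext i; fin_cases i; rfl
  rw [(h1.clm_apply hX.hasFDerivAt).fderiv]
  simp [C, ContinuousAlternatingMap.curryLeft_apply_apply, hv, add_comm]

/-- Cartan's formula for a closed `2`-form on a normed space. -/
theorem cartan_formula_closed_twoForm {Ω : E → E [⋀^Fin 2]→L[ℝ] ℝ} {X : E → E} {y : E}
    (hΩ : DifferentiableAt ℝ Ω y) (hX : DifferentiableAt ℝ X y) (hd : extDeriv Ω y = 0)
    (v : Fin 2 → E) :
    extDeriv (fun z => (Ω z).curryLeft (X z)) y v =
      fderiv ℝ Ω y (X y) v +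
        ∑ j, Ω y (Function.update v j (fderiv ℝ X y (v j))) := by
  rw [extDeriv_oneForm_apply, fderiv_curryLeft_apply_const hΩ hX,
    fderiv_curryLeft_apply_const hΩ hX, Fin.sum_univ_two]
  have h := congrArg (fun f => f ![X y, v 0, v 1]) hd
  have r0 : Fin.removeNth 0 ![X y, v 0, v 1] = v := by
    funext i; fin_cases i <;> rfl
  have r1 : Fin.removeNth 1 ![X y, v 0, v 1] = ![X y, v 1] := by
    funext i; fin_cases i <;> rfl
  have r2 : Fin.removeNth 2 ![X y, v 0, v 1] = ![X y, v 0] := by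
    funext i; fin_cases i <;> rfl
  rw [extDeriv, ContinuousAlternatingMap.alternatizeUncurryFin_apply, Fin.sum_univ_three,
    r0, r1, r2] at h
  simp only [Fin.isValue, Fin.val_zero, pow_zero, Matrix.cons_val_zero, one_smul, Fin.val_one,
    pow_one, Matrix.cons_val_one, Fin.val_two, even_two, Even.neg_pow, one_pow, Matrix.cons_val,
    ContinuousAlternatingMap.coe_zero, Pi.zero_apply, neg_smul] at h
  have u0 : Function.update v 0 (fderiv ℝ X y (v 0)) = ![fderiv ℝ X y (v 0), v 1] := by
    funext i; fin_cases i <;> simp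
  have u1 : Function.update v 1 (fderiv ℝ X y (v 1)) = ![v 0, fderiv ℝ X y (v 1)] := by
    funext i; fin_cases i <;> simp
  have hs : Ω y ![fderiv ℝ X y (v 1), v 0] = - Ω y ![v 0, fderiv ℝ X y (v 1)] := by
    have := (Ω y).map_swap ![v 0, fderiv ℝ X y (v 1)] (i := 0) (j := 1) (by decide)
    refine Eq.trans ?_ this
    change Ω y _ = Ω y _
    congr 1
    funext i; fin_cases i <;> simp
  rw [u0, u1, hs]
  linarith

/-- A smooth `1`-form that is closed on an open set has smooth local primitives. -/
theorem exists_primitive_of_closed {μ : E → E [⋀^Fin 1]→L[ℝ] ℝ} {s : Set E} (hs : IsOpen s)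
    (hμ : ContDiffOn ℝ ∞ μ s) (hd : ∀ y ∈ s, extDeriv μ y = 0) {y₀ : E} (hy₀ : y₀ ∈ s) :
    ∃ r > 0, Metric.ball y₀ r ⊆ s ∧ ∃ h : E → ℝ, ContDiffOn ℝ ∞ h (Metric.ball y₀ r) ∧
      ∀ y ∈ Metric.ball y₀ r, ∀ v, fderiv ℝ h y v = μ y (fun _ => v) := by
  obtain ⟨r, hr, hrs⟩ := Metric.isOpen_iff.1 hs y₀ hy₀
  let A := (ContinuousAlternatingMap.ofSubsingletonLIE (𝕜 := ℝ) (E := E) (F := ℝ) (0 : Fin 1)).symm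
  let ν : E → E →L[ℝ] ℝ := fun y => A (μ y)
  have hνa : ∀ y v, ν y v = μ y (fun _ => v) := fun y v => rfl
  have hν : ContDiffOn ℝ ∞ ν (Metric.ball y₀ r) :=
    A.contDiff.comp_contDiffOn (hμ.mono hrs)
  have hdμ : ∀ y ∈ Metric.ball y₀ r, DifferentiableAt ℝ μ y := fun y hy =>
    (hμ.contDiffAt (hs.mem_nhds (hrs hy))).differentiableAt (by simp)
  have hfν : ∀ y ∈ Metric.ball y₀ r, ∀ v w, fderiv ℝ ν y v w = fderiv ℝ μ y v (fun _ => w) := by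
    intro y hy v w
    have : HasFDerivAt ν _ y := A.toContinuousLinearEquiv.hasFDerivAt.comp y (hdμ y hy).hasFDerivAt
    rw [this.fderiv]; rfl
  obtain ⟨h, hh⟩ := (convex_ball y₀ r).exists_forall_hasFDerivAt_of_fderiv_symmetric
    Metric.isOpen_ball (hν.differentiableOn (by simp)) (by
      intro y hy v w
      have := congrArg (fun f => f ![v, w]) (hd y (hrs hy))
      simp only [extDeriv_oneForm_apply, Matrix.cons_val_zero, Matrix.cons_val_one,
        ContinuousAlternatingMap.coe_zero, Pi.zero_apply] at this
      rw [hfν y hy, hfν y hy]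
      linarith)
  refine ⟨r, hr, hrs, h, ?_, fun y hy v => by rw [(hh y hy).fderiv, hνa]⟩
  rw [contDiffOn_infty_iff_fderiv_of_isOpen Metric.isOpen_ball]
  exact ⟨fun y hy => (hh y hy).differentiableAt.differentiableWithinAt,
    hν.congr fun y hy => (hh y hy).fderiv⟩

end NormedSpaceForms

section ManifoldForms

variable {E : Type*} [NormedAddCommGroup E] [NormedSpace ℝ E]
  {H : Type*} [TopologicalSpace H] {I : ModelWithCorners ℝ E H}
  {M : Type*} [TopologicalSpace M] [ChartedSpace H M]

theorem form_comp_congr {m : ℕ} (η : DForm I M m) {p q : M} {A B : E →L[ℝ] E} (hpq : p = q)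
    (hAB : A = B) :
    (η p).compContinuousLinearMap (A : E →L[ℝ] TangentSpace I p) =
      (η q).compContinuousLinearMap (B : E →L[ℝ] TangentSpace I q) := by
  subst hpq hAB
  rfl

variable [IsManifold I ∞ M]

theorem contMDiffAt_extChartAt_of_mem_source {x u : M} (hu : u ∈ (extChartAt I x).source) :
    ContMDiffAt I 𝓘(ℝ, E) ∞ (extChartAt I x) u :=
  contMDiffAt_extChartAt' (by rwa [extChartAt_source] at hu)

theorem mdifferentiableAt_extChartAt_of_mem_source {x u : M}
    (hu : u ∈ (extChartAt I x).source) :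
    MDifferentiableAt I 𝓘(ℝ, E) (extChartAt I x) u :=
  (contMDiffAt_extChartAt_of_mem_source hu).mdifferentiableAt (by simp)

theorem contMDiffAt_of_contDiffAt_inChart {f : M → ℝ} {x : M} {y : E}
    (hy : y ∈ (extChartAt I x).target)
    (hf : ContDiffAt ℝ ∞ (fun z => f ((extChartAt I x).symm z)) y) :
    ContMDiffAt I 𝓘(ℝ, ℝ) ∞ f ((extChartAt I x).symm y) := by
  have hs := (extChartAt I x).map_target hy
  have h := ContMDiffAt.comp ((extChartAt I x).symm y) (g := fun z => f ((extChartAt I x).symm z))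
    (I' := 𝓘(ℝ, E))
    (by rw [(extChartAt I x).right_inv hy]; exact hf.contMDiffAt)
    (contMDiffAt_extChartAt_of_mem_source hs)
  refine h.congr_of_eventuallyEq ?_
  filter_upwards [(isOpen_extChartAt_source x).mem_nhds hs] with z hz
  exact congrArg f ((extChartAt I x).left_inv hz).symm

variable [I.Boundaryless]

theorem contMDiffAt_extChartAt_symm_of_mem {x : M} {y : E} (hy : y ∈ (extChartAt I x).target) :
    ContMDiffAt 𝓘(ℝ, E) I ∞ (extChartAt I x).symm y :=
  (contMDiffOn_extChartAt_symm x).contMDiffAt ((isOpen_extChartAt_target x).mem_nhds hy)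

theorem mdifferentiableAt_extChartAt_symm_of_mem {x : M} {y : E}
    (hy : y ∈ (extChartAt I x).target) :
    MDifferentiableAt 𝓘(ℝ, E) I (extChartAt I x).symm y :=
  (contMDiffAt_extChartAt_symm_of_mem hy).mdifferentiableAt (by simp)

theorem mfderiv_extChartAt_mfderiv_symm {x : M} {y : E} (hy : y ∈ (extChartAt I x).target)
    (w : E) :
    mfderiv I 𝓘(ℝ, E) (extChartAt I x) ((extChartAt I x).symm y)
      (mfderiv 𝓘(ℝ, E) I (extChartAt I x).symm y w) = w := by
  have : IsManifold I 1 M := .of_le (n := ∞) (by simp)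
  have h := mfderiv_extChartAt_comp_mfderivWithin_extChartAt_symm (I := I) hy
  rw [ModelWithCorners.Boundaryless.range_eq_univ, mfderivWithin_univ] at h
  exact congrArg (fun A : E →L[ℝ] E => A w) h

theorem mfderiv_symm_mfderiv_extChartAt {x : M} {y : E} (hy : y ∈ (extChartAt I x).target)
    (v : E) :
    mfderiv 𝓘(ℝ, E) I (extChartAt I x).symm y
      (mfderiv I 𝓘(ℝ, E) (extChartAt I x) ((extChartAt I x).symm y) v) = v := by
  have : IsManifold I 1 M := .of_le (n := ∞) (by simp)
  have h := mfderivWithin_extChartAt_symm_comp_mfderiv_extChartAt (I := I) hy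
  rw [ModelWithCorners.Boundaryless.range_eq_univ, mfderivWithin_univ] at h
  exact congrArg (fun A : E →L[ℝ] E => A v) h

theorem isInvertible_mfderiv_extChartAt_symm {x : M} {y : E}
    (hy : y ∈ (extChartAt I x).target) :
    (mfderiv 𝓘(ℝ, E) I (extChartAt I x).symm y).IsInvertible := by
  have : IsManifold I 1 M := .of_le (n := ∞) (by simp)
  have h := isInvertible_mfderivWithin_extChartAt_symm (I := I) hy
  rwa [ModelWithCorners.Boundaryless.range_eq_univ, mfderivWithin_univ] at h

theorem mfderiv_symm_fieldInChart (X : Π x : M, TangentSpace I x) {x : M} {y : E}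
    (hy : y ∈ (extChartAt I x).target) :
    mfderiv 𝓘(ℝ, E) I (extChartAt I x).symm y (fieldInChart (E := E) (I := I) X x y) =
      X ((extChartAt I x).symm y) := by
  exact (isInvertible_mfderiv_extChartAt_symm hy).self_apply_inverse _

theorem contDiffOn_fieldInChart [CompleteSpace E] {X : Π x : M, TangentSpace I x}
    (hX : ContMDiff I I.tangent ∞ (fun u => (⟨u, X u⟩ : TangentBundle I M))) (x : M) :
    ContDiffOn ℝ ∞ (fieldInChart X x) (extChartAt I x).target := by
  intro y hy
  refine ContDiffAt.contDiffWithinAt ?_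
  refine contMDiffAt_vectorSpace_iff_contDiffAt.1 ?_
  have : IsManifold I (∞ + 1) M := ‹IsManifold I ∞ M›
  exact ContMDiffAt.mpullback_vectorField_preimage (n := ∞) (hX _)
    (contMDiffAt_extChartAt_symm_of_mem hy) (isInvertible_mfderiv_extChartAt_symm hy) (by simp)

theorem mfderiv_apply_mfderiv_symm {f : M → ℝ} {x : M} {y : E}
    (hy : y ∈ (extChartAt I x).target)
    (hf : MDifferentiableAt I 𝓘(ℝ, ℝ) f ((extChartAt I x).symm y)) (w : E) :
    mfderiv I 𝓘(ℝ, ℝ) f ((extChartAt I x).symm y)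
      (mfderiv 𝓘(ℝ, E) I (extChartAt I x).symm y w) =
      fderiv ℝ (fun z => f ((extChartAt I x).symm z)) y w := by
  have h := mfderiv_comp y hf (mdifferentiableAt_extChartAt_symm_of_mem hy)
  rw [mfderiv_eq_fderiv] at h
  exact (congrArg (fun A : E →L[ℝ] ℝ => A w) h).symm

theorem contDiffAt_chart_transition {x x₀ : M} {y : E} (hy : y ∈ (extChartAt I x).target)
    (hy₀ : (extChartAt I x).symm y ∈ (extChartAt I x₀).source) :
    ContDiffAt ℝ ∞ (fun z => extChartAt I x₀ ((extChartAt I x).symm z)) y :=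
  contMDiffAt_iff_contDiffAt.1 <|
    (contMDiffAt_extChartAt_of_mem_source hy₀).comp y (contMDiffAt_extChartAt_symm_of_mem hy)

/-- The expressions of a form in two charts are related by pullback along the transition map. -/
theorem inChart_eq_pullback {m : ℕ} (η : DForm I M m) {x x₀ : M} {y : E}
    (hy : y ∈ (extChartAt I x).target)
    (hy₀ : (extChartAt I x).symm y ∈ (extChartAt I x₀).source) :
    DForm.inChart η x y =
      (DForm.inChart η x₀ (extChartAt I x₀ ((extChartAt I x).symm y))).compContinuousLinearMap
        (fderiv ℝ (fun z => extChartAt I x₀ ((extChartAt I x).symm z)) y) := by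
  set ψ : E → E := fun z => extChartAt I x₀ ((extChartAt I x).symm z)
  have hmem : ψ y ∈ (extChartAt I x₀).target := (extChartAt I x₀).map_source hy₀
  have hev : (extChartAt I x).symm =ᶠ[𝓝 y] (extChartAt I x₀).symm ∘ ψ := by
    have hc := (continuousAt_extChartAt_symm'' hy).preimage_mem_nhds
      ((isOpen_extChartAt_source x₀).mem_nhds hy₀)
    filter_upwards [hc] with z hz
    exact ((extChartAt I x₀).left_inv hz).symm
  have hψ : DifferentiableAt ℝ ψ y :=
    (contDiffAt_chart_transition hy hy₀).differentiableAt (by simp)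
  have hd := hev.mfderiv_eq (I := 𝓘(ℝ, E)) (I' := I)
  rw [mfderiv_comp y (mdifferentiableAt_extChartAt_symm_of_mem hmem) hψ.mdifferentiableAt,
    mfderiv_eq_fderiv] at hd
  exact form_comp_congr η hev.eq_of_nhds hd

/-- The exterior derivative may be computed in any chart. -/
theorem inChart_extD {m : ℕ} {η : DForm I M m} {x : M} {y : E}
    (hy : y ∈ (extChartAt I x).target) (hη : DifferentiableAt ℝ (DForm.inChart η x) y) :
    DForm.inChart (extD η) x y = extDeriv (DForm.inChart η x) y := by
  have : IsManifold I 1 M := .of_le (n := ∞) (by simp)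
  set u : M := (extChartAt I x).symm y with hu
  have hus : u ∈ (extChartAt I x).source := (extChartAt I x).map_target hy
  have hut : extChartAt I u u ∈ (extChartAt I u).target := mem_extChartAt_target u
  have hinv : (extChartAt I u).symm (extChartAt I u u) = u := extChartAt_to_inv u
  set ψ : E → E := fun z => extChartAt I x ((extChartAt I u).symm z)
  have hψy : ψ (extChartAt I u u) = y := by
    simp only [ψ, hinv]; exact (extChartAt I x).right_inv hy
  have hev : DForm.inChart η u =ᶠ[𝓝 (extChartAt I u u)] fun z =>
      (DForm.inChart η x (ψ z)).compContinuousLinearMap (fderiv ℝ ψ z) := by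
    have hc := (continuousAt_extChartAt_symm'' hut).preimage_mem_nhds
      ((isOpen_extChartAt_source x).mem_nhds (by rw [hinv]; exact hus))
    filter_upwards [hc, (isOpen_extChartAt_target u).mem_nhds hut] with z hz hz'
    exact inChart_eq_pullback η hz' hz
  have hψ : ContDiffAt ℝ ∞ ψ (extChartAt I u u) :=
    contDiffAt_chart_transition hut (by rw [hinv]; exact hus)
  have hA : ∀ w : E, fderiv ℝ ψ (extChartAt I u u)
      (mfderiv I 𝓘(ℝ, E) (extChartAt I u) u (mfderiv 𝓘(ℝ, E) I (extChartAt I x).symm y w)) =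
      w := by
    intro w
    have h1 : (fun z => ψ (extChartAt I u z)) =ᶠ[𝓝 u] extChartAt I x := by
      filter_upwards [(isOpen_extChartAt_source (I := I) u).mem_nhds (mem_extChartAt_source u)] with z hz
      simp only [ψ, (extChartAt I u).left_inv hz]
    have h2 := Filter.EventuallyEq.mfderiv_eq (I := I) (I' := 𝓘(ℝ, E)) h1
    have h3 := mfderiv_comp (I := I) (I' := 𝓘(ℝ, E)) (I'' := 𝓘(ℝ, E)) u
      (hψ.differentiableAt (by simp)).mdifferentiableAt
      (mdifferentiableAt_extChartAt_of_mem_source (I := I) (mem_extChartAt_source u))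
    rw [mfderiv_eq_fderiv] at h3
    have h4 : ((fderiv ℝ ψ (extChartAt I u u)).comp (mfderiv I 𝓘(ℝ, E) (extChartAt I u) u) :
      E →L[ℝ] E) = mfderiv I 𝓘(ℝ, E) (extChartAt I x) u := h3.symm.trans h2
    exact (congrArg (fun A : E →L[ℝ] E => A (mfderiv 𝓘(ℝ, E) I (extChartAt I x).symm y w)) h4).trans
      (mfderiv_extChartAt_mfderiv_symm hy w)
  ext w
  change extDeriv (DForm.inChart η u) (extChartAt I u u) (fun i =>
    mfderiv I 𝓘(ℝ, E) (extChartAt I u) u (mfderiv 𝓘(ℝ, E) I (extChartAt I x).symm y (w i))) = _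
  rw [hev.extDeriv_eq, extDeriv_pullback (r := ∞) (by rwa [hψy]) hψ
    (by simp only [minSmoothness_of_isRCLikeNormedField]; exact WithTop.coe_le_coe.2 le_top)]
  refine (congrArg (extDeriv (DForm.inChart η x) (ψ (extChartAt I u u)))
    (funext fun i => hA (w i))).trans ?_
  rw [hψy]

end ManifoldForms

section SmoothForms

variable {E : Type*} [NormedAddCommGroup E] [NormedSpace ℝ E]
  {H : Type*} [TopologicalSpace H] {I : ModelWithCorners ℝ E H}
  {M : Type*} [TopologicalSpace M] [ChartedSpace H M]

variable (I) in
/-- The differential of a real function, as a covector. -/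
noncomputable def differential (f : M → ℝ) (u : M) : TangentSpace I u →L[ℝ] ℝ :=
  mfderiv I 𝓘(ℝ, ℝ) f u

/-- A form is smooth if its expressions in all charts are. -/
def DForm.IsSmooth {m : ℕ} (η : DForm I M m) : Prop :=
  ∀ x, ContDiffOn ℝ ∞ (DForm.inChart η x) (extChartAt I x).target

/-- The interior product `i_X Ω` of a vector field and a `2`-form. -/
noncomputable def interiorProduct (X : Π x : M, TangentSpace I x) (Ω : DForm I M 2) :
    DForm I M 1 := fun x =>
  ContinuousAlternatingMap.curryLeft (E := E) (Ω x) (X x)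

theorem interiorProduct_apply (X : Π x : M, TangentSpace I x) (Ω : DForm I M 2) (x : M)
    (v : TangentSpace I x) : interiorProduct X Ω x (fun _ => v) = Ω x ![X x, v] := by
  refine (ContinuousAlternatingMap.curryLeft_apply_apply (E := E) (Ω x) (X x) _).trans ?_
  change Ω x _ = Ω x _
  congr 1
  funext i
  fin_cases i <;> rfl

theorem inChart_neg {m : ℕ} (η : DForm I M m) (x : M) (y : E) :
    DForm.inChart (-η) x y = - DForm.inChart η x y := rfl

theorem DForm.IsSmooth.neg {m : ℕ} {η : DForm I M m} (hη : η.IsSmooth) : (-η).IsSmooth :=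
  fun x => (hη x).neg

variable [I.Boundaryless]

theorem DForm.IsSmooth.contDiffAt {m : ℕ} {η : DForm I M m} (hη : η.IsSmooth) {x : M} {y : E}
    (hy : y ∈ (extChartAt I x).target) : ContDiffAt ℝ ∞ (DForm.inChart η x) y :=
  (hη x).contDiffAt ((isOpen_extChartAt_target x).mem_nhds hy)

theorem DForm.IsSmooth.differentiableAt {m : ℕ} {η : DForm I M m} (hη : η.IsSmooth) {x : M}
    {y : E} (hy : y ∈ (extChartAt I x).target) :
    DifferentiableAt ℝ (DForm.inChart η x) y :=
  (hη.contDiffAt hy).differentiableAt (by simp)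

variable [IsManifold I ∞ M]

theorem contDiffAt_extDeriv {m : ℕ} {η : E → E [⋀^Fin m]→L[ℝ] ℝ} {y : E}
    (hη : ContDiffAt ℝ ∞ η y) : ContDiffAt ℝ ∞ (extDeriv η) y := by
  let C := ContinuousAlternatingMap.alternatizeUncurryFinCLM ℝ E ℝ (n := m)
  exact (hη.fderiv_right (m := ∞) (by simp)).continuousLinearMap_comp C

theorem DForm.IsSmooth.extD {m : ℕ} {η : DForm I M m} (hη : η.IsSmooth) :
    (extD η).IsSmooth := fun _ _ hy =>
  ((contDiffAt_extDeriv (hη.contDiffAt hy)).contDiffWithinAt).congr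
    (fun _ hz => inChart_extD hz (hη.differentiableAt hz))
    (inChart_extD hy (hη.differentiableAt hy))

theorem inChart_interiorProduct (X : Π x : M, TangentSpace I x) (Ω : DForm I M 2) {x : M} {y : E}
    (hy : y ∈ (extChartAt I x).target) :
    DForm.inChart (interiorProduct X Ω) x y =
      (DForm.inChart Ω x y).curryLeft (fieldInChart X x y) := by
  ext v
  refine (ContinuousAlternatingMap.curryLeft_apply_apply (E := E)
    (Ω ((extChartAt I x).symm y)) (X ((extChartAt I x).symm y)) _).trans ?_
  rw [ContinuousAlternatingMap.curryLeft_apply_apply]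
  change Ω ((extChartAt I x).symm y) _ = Ω ((extChartAt I x).symm y) _
  congr 1
  funext i
  refine Fin.cases ?_ (fun j => rfl) i
  exact (mfderiv_symm_fieldInChart X hy).symm

theorem DForm.IsSmooth.interiorProduct [CompleteSpace E] {X : Π x : M, TangentSpace I x}
    (hX : ContMDiff I I.tangent ∞ (fun u => (⟨u, X u⟩ : TangentBundle I M)))
    {Ω : DForm I M 2} (hΩ : Ω.IsSmooth) : (interiorProduct X Ω).IsSmooth := by
  intro x
  let C := (ContinuousAlternatingMap.curryLeftLI (𝕜 := ℝ) (E := E) (F := ℝ)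
    (n := 1)).toContinuousLinearMap
  have h := (hΩ x).continuousLinearMap_comp (G := E →L[ℝ] (E [⋀^Fin 1]→L[ℝ] ℝ)) C
  have h' : ContDiffOn ℝ ∞ (fun z => (DForm.inChart Ω x z).curryLeft) (extChartAt I x).target := h
  exact (h'.clm_apply (contDiffOn_fieldInChart hX x)).congr
    fun y hy => inChart_interiorProduct X Ω hy

theorem inChart_contract (X : Π x : M, TangentSpace I x) (η : DForm I M 1) {x : M} {y : E}
    (hy : y ∈ (extChartAt I x).target) :
    DForm.inChart η x y (fun _ => fieldInChart X x y) =
      η ((extChartAt I x).symm y) (fun _ => X ((extChartAt I x).symm y)) :=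
  congrArg (fun v => η ((extChartAt I x).symm y) (fun _ => v)) (mfderiv_symm_fieldInChart X hy)

theorem contDiffAt_contract [CompleteSpace E] {X : Π x : M, TangentSpace I x}
    (hX : ContMDiff I I.tangent ∞ (fun u => (⟨u, X u⟩ : TangentBundle I M)))
    {η : DForm I M 1} (hη : η.IsSmooth) {x : M} {y : E} (hy : y ∈ (extChartAt I x).target) :
    ContDiffAt ℝ ∞ (fun z => DForm.inChart η x z (fun _ => fieldInChart X x z)) y := by
  let A := (ContinuousAlternatingMap.ofSubsingletonLIE (𝕜 := ℝ) (E := E) (F := ℝ)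
    (0 : Fin 1)).symm.toContinuousLinearEquiv.toContinuousLinearMap
  have h := ContDiff.comp_contDiffAt (g := A) y A.contDiff (hη.contDiffAt hy)
  exact h.clm_apply ((contDiffOn_fieldInChart hX x).contDiffAt
    ((isOpen_extChartAt_target x).mem_nhds hy))

/-- The contraction of a smooth `1`-form with a smooth vector field is a smooth function. -/
theorem contMDiff_contract [CompleteSpace E] {X : Π x : M, TangentSpace I x}
    (hX : ContMDiff I I.tangent ∞ (fun u => (⟨u, X u⟩ : TangentBundle I M)))
    {η : DForm I M 1} (hη : η.IsSmooth) :
    ContMDiff I 𝓘(ℝ, ℝ) ∞ (fun x => η x (fun _ => X x)) := by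
  intro u
  have hu := mem_extChartAt_target (I := I) u
  have h : ContDiffAt ℝ ∞ (fun z => η ((extChartAt I u).symm z)
      (fun _ => X ((extChartAt I u).symm z))) (extChartAt I u u) := by
    refine (contDiffAt_contract hX hη hu).congr_of_eventuallyEq ?_
    filter_upwards [(isOpen_extChartAt_target u).mem_nhds hu] with z hz
    exact (inChart_contract X η hz).symm
  have h' := contMDiffAt_of_contDiffAt_inChart (f := fun x => η x (fun _ => X x)) hu h
  rwa [extChartAt_to_inv] at h'

theorem mfderiv_eq_fderiv_inChart {f : M → ℝ} {u : M} (hf : MDifferentiableAt I 𝓘(ℝ, ℝ) f u)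
    (v : TangentSpace I u) :
    differential I f u v = fderiv ℝ (fun z => f ((extChartAt I u).symm z)) (extChartAt I u u)
      (mfderiv I 𝓘(ℝ, E) (extChartAt I u) u v) := by
  have hu := mem_extChartAt_target (I := I) u
  have : IsManifold I 1 M := .of_le (n := ∞) (by simp)
  have h : (mfderiv I 𝓘(ℝ, E) (extChartAt I u) u v : E) = v :=
    congrArg (fun A : E →L[ℝ] E => A v) (mfderiv_extChartAt_self (I := I) (x := u))
  have hd : differential I f u =
      fderiv ℝ (fun z => f ((extChartAt I u).symm z)) (extChartAt I u u) := by
    refine (if_pos hf : mfderiv I 𝓘(ℝ, ℝ) f u = _).trans ?_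
    rw [ModelWithCorners.Boundaryless.range_eq_univ, fderivWithin_univ]
    rfl
  refine (congrArg (fun A : E →L[ℝ] ℝ => A v) hd).trans ?_
  exact congrArg (fderiv ℝ (fun z => f ((extChartAt I u).symm z)) (extChartAt I u u)) h.symm

theorem mfderiv_extChartAt_eq_fieldInChart (X : Π x : M, TangentSpace I x) (u : M) :
    mfderiv I 𝓘(ℝ, E) (extChartAt I u) u (X u) =
      fieldInChart (E := E) (I := I) X u (extChartAt I u u) := by
  have hu := mem_extChartAt_target (I := I) u
  have h1 := mfderiv_extChartAt_mfderiv_symm hu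
    (fieldInChart (E := E) (I := I) X u (extChartAt I u u))
  rw [mfderiv_symm_fieldInChart X hu] at h1
  have key : ∀ p, p = u → (mfderiv I 𝓘(ℝ, E) (extChartAt I u) p (X p) : E) =
      mfderiv I 𝓘(ℝ, E) (extChartAt I u) u (X u) := fun p hp => by subst hp; rfl
  exact (key _ (extChartAt_to_inv u)).symm.trans h1

/-- Cartan's formula `L_X η = i_X dη + d (η(X))` for smooth `1`-forms. -/
theorem lieDeriv_oneForm [CompleteSpace E] {X : Π x : M, TangentSpace I x}
    (hX : ContMDiff I I.tangent ∞ (fun u => (⟨u, X u⟩ : TangentBundle I M)))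
    {η : DForm I M 1} (hη : η.IsSmooth) (u : M) (v : TangentSpace I u) :
    lieDeriv X η u (fun _ => v) =
      extD η u ![X u, v] + differential I (fun x => η x (fun _ => X x)) u v := by
  have hu := mem_extChartAt_target (I := I) u
  have hXu : DifferentiableAt ℝ (fieldInChart (E := E) (I := I) X u) (extChartAt I u u) :=
    ((contDiffOn_fieldInChart hX u).contDiffAt
      ((isOpen_extChartAt_target u).mem_nhds hu)).differentiableAt (by simp)
  rw [mfderiv_eq_fderiv_inChart ((contMDiff_contract hX hη u).mdifferentiableAt (by simp))]
  have hev : (fun z => η ((extChartAt I u).symm z) (fun _ => X ((extChartAt I u).symm z)))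
      =ᶠ[𝓝 (extChartAt I u u)] fun z => DForm.inChart η u z (fun _ => fieldInChart X u z) := by
    filter_upwards [(isOpen_extChartAt_target u).mem_nhds hu] with z hz
    exact (inChart_contract X η hz).symm
  rw [hev.fderiv_eq]
  have hc := cartan_formula_oneForm (hη.differentiableAt hu) hXu
    (mfderiv I 𝓘(ℝ, E) (extChartAt I u) u v)
  refine Eq.trans ?_ (hc.trans ?_)
  · simp only [lieDeriv, Fin.sum_univ_one]
    congr 2
    funext i
    rw [Subsingleton.elim i 0]
    exact Function.update_self (β := fun _ : Fin 1 => E) 0 _ _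
  · congr 1
    change _ = extDeriv (DForm.inChart η u) (extChartAt I u u) _
    congr 1
    funext i
    refine Fin.cases ?_ (fun j => ?_) i
    · exact (mfderiv_extChartAt_eq_fieldInChart X u).symm
    · rw [Subsingleton.elim j 0]; rfl

/-- If a vector field preserves the exact `2`-form `-dη`, then its interior product with this form
is closed. -/
theorem extD_interiorProduct_eq_zero [CompleteSpace E] {X : Π x : M, TangentSpace I x}
    (hX : ContMDiff I I.tangent ∞ (fun u => (⟨u, X u⟩ : TangentBundle I M)))
    {η : DForm I M 1} (hη : η.IsSmooth) {u : M}
    (hL : ∀ v : Fin 2 → TangentSpace I u, lieDeriv X (-extD η) u v = 0) :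
    extD (interiorProduct X (-extD η)) u = 0 := by
  have hu := mem_extChartAt_target (I := I) u
  have hΩ : (-extD η).IsSmooth := hη.extD.neg
  have hXu : DifferentiableAt ℝ (fieldInChart (E := E) (I := I) X u) (extChartAt I u u) :=
    ((contDiffOn_fieldInChart hX u).contDiffAt
      ((isOpen_extChartAt_target u).mem_nhds hu)).differentiableAt (by simp)
  have hev : DForm.inChart (-extD η) u =ᶠ[𝓝 (extChartAt I u u)]
      -extDeriv (DForm.inChart η u) := by
    filter_upwards [(isOpen_extChartAt_target u).mem_nhds hu] with z hz
    rw [inChart_neg, inChart_extD hz (hη.differentiableAt hz)]; rfl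
  have hcl : extDeriv (DForm.inChart (-extD η) u) (extChartAt I u u) = 0 := by
    rw [hev.extDeriv_eq, ← neg_one_smul ℝ, extDeriv_smul,
      extDeriv_extDeriv_apply (hη.contDiffAt hu)
        (by simp only [minSmoothness_of_isRCLikeNormedField]; exact WithTop.coe_le_coe.2 le_top),
      smul_zero]
  have hev2 : DForm.inChart (interiorProduct X (-extD η)) u =ᶠ[𝓝 (extChartAt I u u)]
      fun z => (DForm.inChart (-extD η) u z).curryLeft (fieldInChart X u z) := by
    filter_upwards [(isOpen_extChartAt_target u).mem_nhds hu] with z hz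
    exact inChart_interiorProduct X _ hz
  ext v
  change extDeriv (DForm.inChart (interiorProduct X (-extD η)) u) (extChartAt I u u)
    (fun j => mfderiv I 𝓘(ℝ, E) (extChartAt I u) u (v j)) = 0
  rw [hev2.extDeriv_eq]
  exact (cartan_formula_closed_twoForm (hΩ.differentiableAt hu) hXu hcl _).trans (hL v)

/-- A smooth closed `1`-form has smooth local primitives. -/
theorem DForm.IsSmooth.exists_local_primitive {μ : DForm I M 1} (hμ : μ.IsSmooth)
    (hd : ∀ u, KSymplectic.extD μ u = 0) (u₀ : M) :
    ∃ (W : Set M) (h : M → ℝ), IsOpen W ∧ u₀ ∈ W ∧ ContMDiffOn I 𝓘(ℝ, ℝ) ∞ h W ∧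
      ∀ u ∈ W, ∀ v : TangentSpace I u, differential I h u v = μ u (fun _ => v) := by
  set e := extChartAt I u₀
  obtain ⟨r, hr, hrs, h, hh, hhd⟩ := exists_primitive_of_closed (isOpen_extChartAt_target u₀)
    (hμ u₀) (fun y hy => by
      rw [← inChart_extD hy (hμ.differentiableAt hy)]
      ext w
      change KSymplectic.extD μ _ _ = 0
      rw [hd]; rfl) (mem_extChartAt_target (I := I) u₀)
  have hsrc : e.source ∩ e ⁻¹' Metric.ball (e u₀) r ⊆ e.source := inter_subset_left
  have hsm : ContMDiffOn I 𝓘(ℝ, ℝ) ∞ (fun u => h (e u))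
      (e.source ∩ e ⁻¹' Metric.ball (e u₀) r) := fun u hu =>
    ((hh.contDiffAt (Metric.isOpen_ball.mem_nhds hu.2)).contMDiffAt.comp u
      (contMDiffAt_extChartAt_of_mem_source hu.1)).contMDiffWithinAt
  refine ⟨e.source ∩ e ⁻¹' Metric.ball (e u₀) r, fun u => h (e u),
    (continuousOn_extChartAt u₀).isOpen_inter_preimage (isOpen_extChartAt_source u₀)
      Metric.isOpen_ball, ⟨mem_extChartAt_source u₀, by simpa using hr⟩, hsm, ?_⟩
  intro u hu v
  have hde : MDifferentiableAt I 𝓘(ℝ, E) e u := mdifferentiableAt_extChartAt_of_mem_source hu.1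
  have hdh : DifferentiableAt ℝ h (e u) :=
    (hh.contDiffAt (Metric.isOpen_ball.mem_nhds hu.2)).differentiableAt (by simp)
  have h1 := mfderiv_comp (I := I) (I' := 𝓘(ℝ, E)) (I'' := 𝓘(ℝ, ℝ)) u hdh.mdifferentiableAt hde
  rw [mfderiv_eq_fderiv] at h1
  refine (congrArg (fun A : E →L[ℝ] ℝ => A v) h1).trans ?_
  refine (hhd (e u) hu.2 _).trans ?_
  have h2 := mfderiv_symm_mfderiv_extChartAt (I := I) (e.map_source hu.1)
  have key : ∀ p, p = u → ∀ w : E, mfderiv 𝓘(ℝ, E) I e.symm (e u)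
      (mfderiv I 𝓘(ℝ, E) e p w) = w → μ p (fun _ => mfderiv 𝓘(ℝ, E) I e.symm (e u)
      (mfderiv I 𝓘(ℝ, E) e u w)) = μ u (fun _ => w) := by
    intro p hp w hw
    subst hp
    exact congrArg (fun a : E => μ p (fun _ => a)) hw
  exact key _ (e.left_inv hu.1) v (h2 v)

end SmoothForms

section VelocityCharts

variable {n k : ℕ} {Q : Type*} [TopologicalSpace Q] [ChartedSpace (Euc n) Q]
  [IsManifold (𝓡 n) ∞ Q]

theorem mem_extChartAt_vel_target {u₀ : T1 n k Q} {p : Euc n × (Fin k → Euc n)} :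
    p ∈ (extChartAt (velModel n k) u₀).target ↔ p.1 ∈ (chartAt (Euc n) u₀.proj).target := by
  rw [FiberBundle.extChartAt_target]
  have : (trivializationAt (Fin k → Euc n) (velCore n k Q).Fiber u₀.proj).baseSet =
    (chartAt (Euc n) u₀.proj).source := rfl
  rw [this]
  simp only [mem_prod, mem_univ, and_true, mem_inter_iff, mem_preimage, mfld_simps]
  exact ⟨fun h => h.1, fun h => ⟨h, (chartAt (Euc n) u₀.proj).map_target h⟩⟩

theorem mfderiv_chart_symm_eq_coordChange {q₀ : Q} {x : Euc n}
    (hx : x ∈ (chartAt (Euc n) q₀).target) :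
    tangentCoordChange (𝓡 n) q₀ ((chartAt (Euc n) q₀).symm x) ((chartAt (Euc n) q₀).symm x) =
      mfderiv (𝓡 n) (𝓡 n) (chartAt (Euc n) q₀).symm x := by
  have hd : MDifferentiableAt (𝓡 n) (𝓡 n) (chartAt (Euc n) q₀).symm x :=
    mdifferentiableAt_atlas_symm (chart_mem_atlas _ _) hx
  rw [tangentCoordChange_def]
  refine Eq.trans ?_ (if_pos hd).symm
  simp only [mfld_simps, (chartAt (Euc n) q₀).right_inv hx]
  rfl

theorem extChartAt_vel_symm_apply {u₀ : T1 n k Q} {p : Euc n × (Fin k → Euc n)}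
    (hp : p.1 ∈ (chartAt (Euc n) u₀.proj).target) :
    (extChartAt (velModel n k) u₀).symm p =
      mkVel ((chartAt (Euc n) u₀.proj).symm p.1) fun α =>
        mfderiv (𝓡 n) (𝓡 n) (chartAt (Euc n) u₀.proj).symm p.1 (p.2 α) := by
  rw [FiberBundle.extChartAt]
  rw [← mfderiv_chart_symm_eq_coordChange hp]
  rfl

/-- The differential of the inverse of the chart of `Q` around `q₀`, at the point `x`. -/
noncomputable def chartSymmDeriv (q₀ : Q) (x : Euc n) : Euc n →L[ℝ] Euc n :=
  mfderiv (𝓡 n) (𝓡 n) (chartAt (Euc n) q₀).symm x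

theorem extChartAt_vel_symm_eq {u₀ : T1 n k Q} {p : Euc n × (Fin k → Euc n)}
    (hp : p.1 ∈ (chartAt (Euc n) u₀.proj).target) :
    (extChartAt (velModel n k) u₀).symm p =
      mkVel ((chartAt (Euc n) u₀.proj).symm p.1) (diagL n k (chartSymmDeriv u₀.proj p.1) p.2) :=
  extChartAt_vel_symm_apply hp

theorem vel_extChartAt_symm {u₀ : T1 n k Q} {p : Euc n × (Fin k → Euc n)}
    (hp : p.1 ∈ (chartAt (Euc n) u₀.proj).target) :
    (vel ((extChartAt (velModel n k) u₀).symm p) : Fin k → Euc n) =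
      diagL n k (chartSymmDeriv u₀.proj p.1) p.2 := by
  have key : ∀ (u : T1 n k Q) (q : Q) (v : Fin k → Euc n), u = mkVel q v →
      (vel u : Fin k → Euc n) = v := fun u q v h => by subst h; rfl
  exact key _ _ _ (extChartAt_vel_symm_eq hp)

theorem contMDiff_mkVel (q : Q) : ContMDiff 𝓘(ℝ, Fin k → Euc n) (velModel n k) ∞
    (fun v : Fin k → Euc n => (mkVel q v : T1 n k Q)) := by
  intro v
  rw [contMDiffAt_totalSpace]
  refine ⟨contMDiffAt_const, ?_⟩
  refine contMDiffAt_id.congr_of_eventuallyEq (Filter.Eventually.of_forall fun w => ?_)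
  exact congrArg Prod.snd ((velCore n k Q).localTrivAt_apply_mk q w)

theorem vertLift_chartSymmDeriv {u₀ : T1 n k Q} {p : Euc n × (Fin k → Euc n)}
    (hp : p.1 ∈ (chartAt (Euc n) u₀.proj).target) (w : Fin k → Euc n) :
    vertLift ((extChartAt (velModel n k) u₀).symm p) (diagL n k (chartSymmDeriv u₀.proj p.1) w) =
      mfderiv 𝓘(ℝ, Euc n × (Fin k → Euc n)) (velModel n k) (extChartAt (velModel n k) u₀).symm p
        (0, w) := by
  set q := (chartAt (Euc n) u₀.proj).symm p.1
  set A := diagL n k (chartSymmDeriv u₀.proj p.1)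
  have key : ∀ (u : T1 n k Q) (v : Fin k → Euc n), u = mkVel q v →
      (vertLift u (A w) : Euc n × (Fin k → Euc n)) =
        mfderiv 𝓘(ℝ, Fin k → Euc n) (velModel n k)
          (fun v : Fin k → Euc n => (mkVel q v : T1 n k Q)) v (A w) :=
    fun u v h => by subst h; rfl
  refine (key _ _ (extChartAt_vel_symm_eq hp)).trans ?_
  have heq : (fun v : Fin k → Euc n => (extChartAt (velModel n k) u₀).symm (p.1, v)) =
      fun v => (mkVel q (A v) : T1 n k Q) := funext fun v => extChartAt_vel_symm_eq (p := (p.1, v)) hp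
  have h1 := mfderiv_comp (I := 𝓘(ℝ, Fin k → Euc n)) (I' := 𝓘(ℝ, Fin k → Euc n))
    (I'' := velModel n k) p.2 (f := A) (g := fun v : Fin k → Euc n => (mkVel q v : T1 n k Q))
    ((contMDiff_mkVel q _).mdifferentiableAt (by simp)) A.mdifferentiableAt
  have hin : HasFDerivAt (fun v : Fin k → Euc n => (p.1, v))
      (ContinuousLinearMap.inr ℝ (Euc n) (Fin k → Euc n)) p.2 := hasFDerivAt_prodMk_right _ _
  have h2 := mfderiv_comp (I := 𝓘(ℝ, Fin k → Euc n)) (I' := 𝓘(ℝ, Euc n × (Fin k → Euc n)))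
    (I'' := velModel n k) p.2 (f := fun v : Fin k → Euc n => (p.1, v))
    (g := (extChartAt (velModel n k) u₀).symm)
    (mdifferentiableAt_extChartAt_symm_of_mem (mem_extChartAt_vel_target.2 hp))
    hin.differentiableAt.mdifferentiableAt
  rw [mfderiv_eq_fderiv, A.fderiv] at h1
  rw [mfderiv_eq_fderiv, hin.fderiv] at h2
  have h3 := Filter.EventuallyEq.mfderiv_eq (I := 𝓘(ℝ, Fin k → Euc n)) (I' := velModel n k)
    (x := p.2) (Filter.EventuallyEq.of_eq heq)
  have h4 := (h1.symm.trans h3.symm).trans h2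
  exact congrArg (fun B : (Fin k → Euc n) →L[ℝ] Euc n × (Fin k → Euc n) => B w) h4

theorem dProj_mfderiv_symm {u₀ : T1 n k Q} {p : Euc n × (Fin k → Euc n)}
    (hp : p.1 ∈ (chartAt (Euc n) u₀.proj).target) (w : Euc n × (Fin k → Euc n)) :
    dProj ((extChartAt (velModel n k) u₀).symm p)
      (mfderiv 𝓘(ℝ, Euc n × (Fin k → Euc n)) (velModel n k)
        (extChartAt (velModel n k) u₀).symm p w) = chartSymmDeriv u₀.proj p.1 w.1 := by
  have hd : MDifferentiableAt (𝓡 n) (𝓡 n) (chartAt (Euc n) u₀.proj).symm p.1 :=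
    mdifferentiableAt_atlas_symm (chart_mem_atlas _ _) hp
  have h1 := mfderiv_comp (I := 𝓘(ℝ, Euc n × (Fin k → Euc n))) (I' := velModel n k)
    (I'' := 𝓡 n) p (f := (extChartAt (velModel n k) u₀).symm) (g := fun u : T1 n k Q => u.proj)
    ((contMDiff_proj (n := ∞) (velCore n k Q).Fiber _).mdifferentiableAt (by simp))
    (mdifferentiableAt_extChartAt_symm_of_mem (mem_extChartAt_vel_target.2 hp))
  have h2 := mfderiv_comp (I := 𝓘(ℝ, Euc n × (Fin k → Euc n))) (I' := 𝓡 n) (I'' := 𝓡 n) p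
    (f := Prod.fst) (g := (chartAt (Euc n) u₀.proj).symm) hd
    differentiableAt_fst.mdifferentiableAt
  rw [mfderiv_eq_fderiv, fderiv_fst] at h2
  have hev : (fun u : T1 n k Q => u.proj) ∘ (extChartAt (velModel n k) u₀).symm =ᶠ[𝓝 p]
      (chartAt (Euc n) u₀.proj).symm ∘ Prod.fst := by
    filter_upwards [continuous_fst.continuousAt.preimage_mem_nhds
      ((chartAt (Euc n) u₀.proj).open_target.mem_nhds hp)] with z hz
    exact congrArg TotalSpace.proj (extChartAt_vel_symm_eq hz)
  have h3 := Filter.EventuallyEq.mfderiv_eq (I := 𝓘(ℝ, Euc n × (Fin k → Euc n))) (I' := 𝓡 n) hev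
  have h4 := (h1.symm.trans h3).trans h2
  exact congrArg (fun B : Euc n × (Fin k → Euc n) →L[ℝ] Euc n => B w) h4

theorem diagL_single (A : Euc n →L[ℝ] Euc n) (α : Fin k) (w : Euc n) :
    diagL n k A (Pi.single α w) = Pi.single α (A w) := by
  funext β
  rw [diagL_apply]
  rcases eq_or_ne β α with rfl | h
  · simp
  · simp [h]

theorem tangentStructure_mfderiv_symm (α : Fin k) {u₀ : T1 n k Q}
    {p : Euc n × (Fin k → Euc n)} (hp : p.1 ∈ (chartAt (Euc n) u₀.proj).target)
    (w : Euc n × (Fin k → Euc n)) :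
    tangentStructure α ((extChartAt (velModel n k) u₀).symm p)
      (mfderiv 𝓘(ℝ, Euc n × (Fin k → Euc n)) (velModel n k)
        (extChartAt (velModel n k) u₀).symm p w) =
      mfderiv 𝓘(ℝ, Euc n × (Fin k → Euc n)) (velModel n k)
        (extChartAt (velModel n k) u₀).symm p (0, Pi.single α w.1) := by
  rw [← vertLift_chartSymmDeriv hp, diagL_single, ← dProj_mfderiv_symm hp w]
  rfl

theorem dFun_mfderiv_symm {f : T1 n k Q → ℝ} {u₀ : T1 n k Q}
    {p : Euc n × (Fin k → Euc n)} (hp : p.1 ∈ (chartAt (Euc n) u₀.proj).target)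
    (hf : MDifferentiableAt (velModel n k) 𝓘(ℝ, ℝ) f ((extChartAt (velModel n k) u₀).symm p))
    (w : Euc n × (Fin k → Euc n)) :
    dFun f ((extChartAt (velModel n k) u₀).symm p)
      (mfderiv 𝓘(ℝ, Euc n × (Fin k → Euc n)) (velModel n k)
        (extChartAt (velModel n k) u₀).symm p w) =
      fderiv ℝ (fun z => f ((extChartAt (velModel n k) u₀).symm z)) p w :=
  mfderiv_apply_mfderiv_symm (mem_extChartAt_vel_target.2 hp) hf w

theorem eventuallyEq_coordLag (L : T1 n k Q → ℝ) {u₀ : T1 n k Q}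
    {p : Euc n × (Fin k → Euc n)} (hp : p.1 ∈ (chartAt (Euc n) u₀.proj).target) :
    (fun z => L ((extChartAt (velModel n k) u₀).symm z)) =ᶠ[𝓝 p]
      coordLag L (chartAt (Euc n) u₀.proj) := by
  filter_upwards [continuous_fst.continuousAt.preimage_mem_nhds
    ((chartAt (Euc n) u₀.proj).open_target.mem_nhds hp)] with z hz
  exact congrArg L (extChartAt_vel_symm_apply hz)

theorem contDiffAt_coordLag {L : T1 n k Q → ℝ} (hL : ContMDiff (velModel n k) 𝓘(ℝ, ℝ) ∞ L)
    {u₀ : T1 n k Q} {p : Euc n × (Fin k → Euc n)}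
    (hp : p.1 ∈ (chartAt (Euc n) u₀.proj).target) :
    ContDiffAt ℝ ∞ (coordLag L (chartAt (Euc n) u₀.proj)) p := by
  refine ContDiffAt.congr_of_eventuallyEq ?_ (eventuallyEq_coordLag L hp).symm
  exact contMDiffAt_iff_contDiffAt.1 ((hL _).comp p
    (contMDiffAt_extChartAt_symm_of_mem (mem_extChartAt_vel_target.2 hp)))

/-- The expression of `θ_L^α` in induced coordinates: `θ_L^α = ∂L/∂v^i_α dq^i`. -/
theorem inChart_theta {L : T1 n k Q → ℝ} (hL : ContMDiff (velModel n k) 𝓘(ℝ, ℝ) ∞ L)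
    (α : Fin k) {u₀ : T1 n k Q} {p : Euc n × (Fin k → Euc n)}
    (hp : p.1 ∈ (chartAt (Euc n) u₀.proj).target) (w : Euc n × (Fin k → Euc n)) :
    DForm.inChart (theta L α) u₀ p (fun _ => w) =
      fderiv ℝ (coordLag L (chartAt (Euc n) u₀.proj)) p (0, Pi.single α w.1) := by
  rw [← (eventuallyEq_coordLag L hp).fderiv_eq,
    ← dFun_mfderiv_symm hp ((hL _).mdifferentiableAt (by simp)),
    ← tangentStructure_mfderiv_symm α hp]
  rfl

/-- The expression of `E_L` in induced coordinates: `E_L = v^i_α ∂L/∂v^i_α - L`. -/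
theorem energy_extChartAt_symm {L : T1 n k Q → ℝ}
    (hL : ContMDiff (velModel n k) 𝓘(ℝ, ℝ) ∞ L) {u₀ : T1 n k Q}
    {p : Euc n × (Fin k → Euc n)} (hp : p.1 ∈ (chartAt (Euc n) u₀.proj).target) :
    energy L ((extChartAt (velModel n k) u₀).symm p) =
      fderiv ℝ (coordLag L (chartAt (Euc n) u₀.proj)) p (0, p.2) -
        coordLag L (chartAt (Euc n) u₀.proj) p := by
  rw [← (eventuallyEq_coordLag L hp).fderiv_eq, ← (eventuallyEq_coordLag L hp).eq_of_nhds,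
    ← dFun_mfderiv_symm hp ((hL _).mdifferentiableAt (by simp)),
    ← vertLift_chartSymmDeriv hp, ← vel_extChartAt_symm hp]
  rfl

end VelocityCharts

section CoordinateEulerLagrange

variable {n k : ℕ}

theorem fderiv_fderiv_apply_const {E F : Type*} [NormedAddCommGroup E] [NormedSpace ℝ E]
    [NormedAddCommGroup F] [NormedSpace ℝ F] {A : E → F →L[ℝ] ℝ} {p : E}
    (hA : DifferentiableAt ℝ A p) (c : F) (a : E) :
    fderiv ℝ (fun z => A z c) p a = fderiv ℝ A p a c := by
  have h := hA.hasFDerivAt.clm_apply (hasFDerivAt_const c p)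
  rw [h.fderiv]
  simp

theorem sum_single_pair (v : Fin k → Euc n) :
    ∑ α, ((0, Pi.single α (v α)) : Euc n × (Fin k → Euc n)) = (0, v) := by
  refine Prod.ext (by simp [Prod.fst_sum]) ?_
  rw [Prod.snd_sum]
  exact Finset.univ_sum_single v

/-- In coordinates, the Euler–Lagrange equations at a point say that `∑_α i_{a_α} ω_L^α = dE_L`,
where `a_α` are the partial derivatives of the first prolongation. -/
theorem sum_extDeriv_eq_fderiv_energy {ℓ : Euc n × (Fin k → Euc n) → ℝ}
    {η : Fin k → (Euc n × (Fin k → Euc n)) → (Euc n × (Fin k → Euc n)) [⋀^Fin 1]→L[ℝ] ℝ}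
    {p : Euc n × (Fin k → Euc n)} (hℓ : ContDiffAt ℝ ∞ ℓ p)
    (hη : ∀ α, DifferentiableAt ℝ (η α) p)
    (hηℓ : ∀ α, ∀ᶠ z in 𝓝 p, ∀ w, η α z (fun _ => w) = fderiv ℝ ℓ z (0, Pi.single α w.1))
    {a : Fin k → Euc n × (Fin k → Euc n)} (ha : ∀ α, (a α).1 = p.2 α)
    (hEL : ∀ i, ∑ α, fderiv ℝ (fderiv ℝ ℓ) p (a α) (0, Pi.single α (stdVec i)) =
      fderiv ℝ ℓ p (stdVec i, 0)) (Y : Euc n × (Fin k → Euc n)) :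
    ∑ α, -extDeriv (η α) p ![a α, Y] =
      fderiv ℝ (fun z => fderiv ℝ ℓ z (0, z.2) - ℓ z) p Y := by
  have hdℓ : DifferentiableAt ℝ ℓ p := hℓ.differentiableAt (by simp)
  have hddℓ : DifferentiableAt ℝ (fderiv ℝ ℓ) p :=
    (hℓ.fderiv_right (m := ∞) (by simp)).differentiableAt (by simp)
  have hD : ∀ α b w, fderiv ℝ (η α) p b (fun _ => w) =
      fderiv ℝ (fderiv ℝ ℓ) p b (0, Pi.single α w.1) := by
    intro α b w
    rw [← fderiv_form_apply_const (hη α), ← fderiv_fderiv_apply_const hddℓ]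
    refine congrArg (fun A : Euc n × (Fin k → Euc n) →L[ℝ] ℝ => A b) ?_
    refine Filter.EventuallyEq.fderiv_eq ?_
    filter_upwards [hηℓ α] with z hz using hz w
  have hEL' : ∀ b : Euc n, ∑ α, fderiv ℝ (fderiv ℝ ℓ) p (a α) (0, Pi.single α b) =
      fderiv ℝ ℓ p (b, 0) := by
    let lhs : Euc n →L[ℝ] ℝ := ∑ α, (fderiv ℝ (fderiv ℝ ℓ) p (a α)).comp
      ((ContinuousLinearMap.inr ℝ (Euc n) (Fin k → Euc n)).comp
        (ContinuousLinearMap.single ℝ (fun _ : Fin k => Euc n) α))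
    let rhs : Euc n →L[ℝ] ℝ := (fderiv ℝ ℓ p).comp
      (ContinuousLinearMap.inl ℝ (Euc n) (Fin k → Euc n))
    have hlr : lhs.toLinearMap = rhs.toLinearMap := by
      refine (EuclideanSpace.basisFun (Fin n) ℝ).toBasis.ext fun i => ?_
      have := hEL i
      simpa [lhs, rhs, stdVec] using this
    intro b
    have := congrArg (fun f => f b) hlr
    simpa [lhs, rhs] using this
  have hE : fderiv ℝ (fun z => fderiv ℝ ℓ z (0, z.2) - ℓ z) p Y =
      fderiv ℝ (fderiv ℝ ℓ) p Y (0, p.2) - fderiv ℝ ℓ p (Y.1, 0) := by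
    have h1 : HasFDerivAt (fun z : Euc n × (Fin k → Euc n) => ((0, z.2) : Euc n × (Fin k → Euc n)))
        ((ContinuousLinearMap.inr ℝ (Euc n) (Fin k → Euc n)).comp
          (ContinuousLinearMap.snd ℝ (Euc n) (Fin k → Euc n))) p :=
      ((ContinuousLinearMap.inr ℝ (Euc n) (Fin k → Euc n)).comp
          (ContinuousLinearMap.snd ℝ (Euc n) (Fin k → Euc n))).hasFDerivAt
    have h2 := (hddℓ.hasFDerivAt.clm_apply h1).sub hdℓ.hasFDerivAt
    have h3 : fderiv ℝ ℓ p Y = fderiv ℝ ℓ p (Y.1, 0) + fderiv ℝ ℓ p (0, Y.2) := by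
      rw [← map_add]; simp
    refine (congrArg (fun A : Euc n × (Fin k → Euc n) →L[ℝ] ℝ => A Y) h2.fderiv).trans ?_
    simp only [sub_apply, add_apply,
      ContinuousLinearMap.comp_apply, ContinuousLinearMap.flip_apply,
      ContinuousLinearMap.inr_apply, ContinuousLinearMap.coe_snd', h3]
    ring
  rw [hE, ← hEL' Y.1, ← sum_single_pair p.2, map_sum, ← Finset.sum_sub_distrib]
  refine Finset.sum_congr rfl fun α _ => ?_
  rw [extDeriv_oneForm_apply]
  simp only [Matrix.cons_val_zero, Matrix.cons_val_one, hD, ha]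
  ring

end CoordinateEulerLagrange

section Prolongation

variable {n k : ℕ} {Q : Type*} [TopologicalSpace Q] [ChartedSpace (Euc n) Q]
  [IsManifold (𝓡 n) ∞ Q]

theorem contDiffAt_chart_comp {φ : Euc k → Q} {t : Euc k} {q₀ : Q}
    (hφ : ContMDiffAt (𝓡 k) (𝓡 n) ∞ φ t) (hq : φ t ∈ (chartAt (Euc n) q₀).source) :
    ContDiffAt ℝ ∞ (fun s => chartAt (Euc n) q₀ (φ s)) t :=
  contMDiffAt_iff_contDiffAt.1 <|
    ((contMDiffOn_chart (I := 𝓡 n) (x := q₀)).contMDiffAt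
      ((chartAt (Euc n) q₀).open_source.mem_nhds hq)).comp t hφ

theorem contDiffAt_coordProlong {φ : Euc k → Q} {t : Euc k} {q₀ : Q}
    (hφ : ContMDiffAt (𝓡 k) (𝓡 n) ∞ φ t) (hq : φ t ∈ (chartAt (Euc n) q₀).source) :
    ContDiffAt ℝ ∞ (coordProlong φ (chartAt (Euc n) q₀)) t := by
  have h := contDiffAt_chart_comp hφ hq
  exact h.prodMk (contDiffAt_pi.2 fun α =>
    (h.fderiv_right (m := ∞) (by simp)).clm_apply contDiffAt_const)

theorem fderiv_coordProlong_fst {φ : Euc k → Q} {t : Euc k} {q₀ : Q}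
    (hφ : ContMDiffAt (𝓡 k) (𝓡 n) ∞ φ t) (hq : φ t ∈ (chartAt (Euc n) q₀).source)
    (α : Fin k) :
    (fderiv ℝ (coordProlong φ (chartAt (Euc n) q₀)) t (stdVec α)).1 =
      (coordProlong φ (chartAt (Euc n) q₀) t).2 α := by
  have h := ((contDiffAt_coordProlong hφ hq).differentiableAt (by simp)).hasFDerivAt.fst
  exact (congrArg (fun A : Euc k →L[ℝ] Euc n => A (stdVec α)) h.fderiv).symm

/-- The first prolongation in induced coordinates. -/
theorem extChartAt_symm_coordProlong {φ : Euc k → Q} {t : Euc k} {u₀ : T1 n k Q}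
    (hφ : ContMDiffAt (𝓡 k) (𝓡 n) ∞ φ t) (hq : φ t ∈ (chartAt (Euc n) u₀.proj).source) :
    (extChartAt (velModel n k) u₀).symm (coordProlong φ (chartAt (Euc n) u₀.proj) t) =
      prolong φ t := by
  set c := chartAt (Euc n) u₀.proj with hc
  have key : ∀ (q q' : Q) (v v' : Fin k → Euc n), q = q' → v = v' →
      (mkVel q v : T1 n k Q) = mkVel q' v' := fun q q' v v' h h' => by subst h h'; rfl
  refine (extChartAt_vel_symm_eq (c.map_source hq)).trans ?_
  refine key _ _ _ _ (c.left_inv hq) (funext fun α => ?_)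
  have hd : MDifferentiableAt (𝓡 n) (𝓡 n) c.symm (c (φ t)) :=
    mdifferentiableAt_atlas_symm (chart_mem_atlas _ _) (c.map_source hq)
  have h1 := mfderiv_comp (I := 𝓡 k) (I' := 𝓡 n) (I'' := 𝓡 n) t
    (f := fun s => c (φ s)) (g := c.symm) hd
    ((contDiffAt_chart_comp hφ hq).differentiableAt (by simp)).mdifferentiableAt
  rw [mfderiv_eq_fderiv] at h1
  have hev : c.symm ∘ (fun s => c (φ s)) =ᶠ[𝓝 t] φ := by
    filter_upwards [hφ.continuousAt.preimage_mem_nhds (c.open_source.mem_nhds hq)] with s hs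
    exact c.left_inv hs
  have h2 := Filter.EventuallyEq.mfderiv_eq (I := 𝓡 k) (I' := 𝓡 n) hev
  exact congrArg (fun A : Euc k →L[ℝ] Euc n => A (stdVec α)) (h1.symm.trans h2)

end Prolongation

section Noether

variable {n k : ℕ} {Q : Type*} [TopologicalSpace Q] [ChartedSpace (Euc n) Q]
  [IsManifold (𝓡 n) ∞ Q] {L : T1 n k Q → ℝ}

theorem isSmooth_theta (hL : ContMDiff (velModel n k) 𝓘(ℝ, ℝ) ∞ L) (α : Fin k) :
    (theta L α).IsSmooth := by
  intro u₀ p hp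
  have hp' := mem_extChartAt_vel_target.1 hp
  let C := (ContinuousAlternatingMap.ofSubsingletonLIE (𝕜 := ℝ) (E := Euc n × (Fin k → Euc n))
    (F := ℝ) (0 : Fin 1)).toContinuousLinearEquiv.toContinuousLinearMap
  let K : Euc n × (Fin k → Euc n) →L[ℝ] Euc n × (Fin k → Euc n) :=
    (ContinuousLinearMap.inr ℝ (Euc n) (Fin k → Euc n)).comp
      ((ContinuousLinearMap.single ℝ (fun _ : Fin k => Euc n) α).comp
        (ContinuousLinearMap.fst ℝ (Euc n) (Fin k → Euc n)))
  have h1 : ContDiffAt ℝ ∞ (fun z => (fderiv ℝ (coordLag L (chartAt (Euc n) u₀.proj)) z).comp K)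
      p := ((contDiffAt_coordLag hL hp').fderiv_right (m := ∞) (by simp)).clm_comp contDiffAt_const
  have h2 := h1.continuousLinearMap_comp C
  refine (h2.congr_of_eventuallyEq ?_).contDiffWithinAt
  filter_upwards [(isOpen_extChartAt_target u₀).mem_nhds hp] with z hz
  ext w
  have hw : w = fun _ => w 0 := by funext i; rw [Subsingleton.elim i 0]
  rw [hw, inChart_theta hL α (mem_extChartAt_vel_target.1 hz)]
  rfl

theorem differential_eq_dFun (f : T1 n k Q → ℝ) (u : T1 n k Q) :
    differential (velModel n k) f u = dFun f u := rfl

theorem exists_isLiePotentialOn (hL : ContMDiff (velModel n k) 𝓘(ℝ, ℝ) ∞ L)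
    {X : Π u : T1 n k Q, TVel u} (hX : IsCartanSymmetry L X) (u₀ : T1 n k Q) :
    ∃ (W : Set (T1 n k Q)) (g : Fin k → T1 n k Q → ℝ), u₀ ∈ W ∧ IsLiePotentialOn L X W g := by
  have hθ := isSmooth_theta (k := k) hL
  have hprim := fun α => ((hθ α).extD.neg.interiorProduct hX.smooth).exists_local_primitive
    (fun u => extD_interiorProduct_eq_zero hX.smooth (hθ α)
      (fun v => hX.lieDeriv_omega α u v)) u₀
  choose W h hWo hWu hh hhd using hprim
  refine ⟨⋂ α, W α, fun α u => theta L α u (fun _ => X u) - h α u, mem_iInter.2 hWu,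
    isOpen_iInter_of_finite hWo, fun α => ?_, fun α u hu v => ?_⟩
  · exact (contMDiff_contract hX.smooth (hθ α)).contMDiffOn.sub
      ((hh α).mono (iInter_subset _ α))
  · have huα := mem_iInter.1 hu α
    have h1 : MDifferentiableAt (velModel n k) 𝓘(ℝ, ℝ) (fun u => theta L α u (fun _ => X u)) u :=
      (contMDiff_contract hX.smooth (hθ α) u).mdifferentiableAt (by simp)
    have h2 : MDifferentiableAt (velModel n k) 𝓘(ℝ, ℝ) (h α) u :=
      ((hh α).contMDiffAt ((hWo α).mem_nhds huα)).mdifferentiableAt (by simp)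
    have h3 : dFun (fun u => theta L α u (fun _ => X u) - h α u) u =
        dFun (fun u => theta L α u (fun _ => X u)) u - dFun (h α) u := mfderiv_sub h1 h2
    rw [lieDeriv_oneForm hX.smooth (hθ α), h3, sub_apply,
      ← differential_eq_dFun, ← differential_eq_dFun, hhd α u huα, interiorProduct_apply]
    simp only [Pi.neg_apply, ContinuousAlternatingMap.neg_apply]
    ring

theorem contMDiffOn_conserved (hL : ContMDiff (velModel n k) 𝓘(ℝ, ℝ) ∞ L)
    {X : Π u : T1 n k Q, TVel u} (hX : IsSmoothField X) {W : Set (T1 n k Q)}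
    {g f : Fin k → T1 n k Q → ℝ} (hg : IsLiePotentialOn L X W g)
    (hf : ∀ α u, f α u = theta L α u (fun _ => X u) - g α u) (α : Fin k) :
    ContMDiffOn (velModel n k) 𝓘(ℝ, ℝ) ∞ (f α) W := by
  rw [funext (hf α)]
  exact (contMDiff_contract hX (isSmooth_theta hL α)).contMDiffOn.sub (hg.smooth α)

/-- The functions `f^α = θ_L^α(X) - g^α` are Hamiltonians of `X`: `i_X ω_L^α = df^α`. -/
theorem omega_eq_dFun (hL : ContMDiff (velModel n k) 𝓘(ℝ, ℝ) ∞ L)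
    {X : Π u : T1 n k Q, TVel u} (hX : IsSmoothField X) {W : Set (T1 n k Q)}
    {g f : Fin k → T1 n k Q → ℝ} (hg : IsLiePotentialOn L X W g)
    (hf : ∀ α u, f α u = theta L α u (fun _ => X u) - g α u) (α : Fin k) {u : T1 n k Q}
    (hu : u ∈ W) (v : TVel u) : omega L α u ![X u, v] = dFun (f α) u v := by
  have hθ := isSmooth_theta (k := k) hL α
  have h1 : MDifferentiableAt (velModel n k) 𝓘(ℝ, ℝ) (fun u => theta L α u (fun _ => X u)) u :=
    (contMDiff_contract hX hθ u).mdifferentiableAt (by simp)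
  have h2 : MDifferentiableAt (velModel n k) 𝓘(ℝ, ℝ) (g α) u :=
    ((hg.smooth α).contMDiffAt (hg.isOpen.mem_nhds hu)).mdifferentiableAt (by simp)
  have h3 : dFun (fun u => theta L α u (fun _ => X u) - g α u) u =
      dFun (fun u => theta L α u (fun _ => X u)) u - dFun (g α) u := mfderiv_sub h1 h2
  rw [funext (hf α), h3, sub_apply, ← hg.lieDeriv_theta α u hu,
    lieDeriv_oneForm hX hθ, differential_eq_dFun]
  simp only [omega, Pi.neg_apply, ContinuousAlternatingMap.neg_apply]
  ring

theorem omega_swap (α : Fin k) (u : T1 n k Q) (v w : TVel u) :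
    omega L α u ![v, w] = - omega L α u ![w, v] := by
  have h := (omega L α u).toAlternatingMap.map_swap ![w, v] (i := 0) (j := 1) (by decide)
  refine Eq.trans ?_ h
  change omega L α u _ = omega L α u _
  congr 1
  funext i; fin_cases i <;> simp

theorem omega_mfderiv_symm (hL : ContMDiff (velModel n k) 𝓘(ℝ, ℝ) ∞ L) (α : Fin k)
    {u₀ : T1 n k Q} {p : Euc n × (Fin k → Euc n)}
    (hp : p ∈ (extChartAt (velModel n k) u₀).target) (w : Fin 2 → Euc n × (Fin k → Euc n)) :
    omega L α ((extChartAt (velModel n k) u₀).symm p) (fun i =>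
      mfderiv 𝓘(ℝ, Euc n × (Fin k → Euc n)) (velModel n k)
        (extChartAt (velModel n k) u₀).symm p (w i)) =
      -extDeriv (DForm.inChart (theta L α) u₀) p w := by
  rw [← inChart_extD hp ((isSmooth_theta hL α).differentiableAt hp)]
  rfl

/-- The partial derivatives of the first prolongation of a solution of the Euler–Lagrange
equations satisfy the geometric Euler–Lagrange equation. -/
theorem IsEulerLagrangeSolution.sum_omega {U : Set (Euc k)} {φ : Euc k → Q}
    (hL : ContMDiff (velModel n k) 𝓘(ℝ, ℝ) ∞ L) (hφ : IsEulerLagrangeSolution L U φ)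
    {t : Euc k} (ht : t ∈ U) {u₀ : T1 n k Q} (hq : φ t ∈ (chartAt (Euc n) u₀.proj).source)
    (Y : Euc n × (Fin k → Euc n)) :
    ∑ α, -extDeriv (DForm.inChart (theta L α) u₀) (coordProlong φ (chartAt (Euc n) u₀.proj) t)
        ![fderiv ℝ (coordProlong φ (chartAt (Euc n) u₀.proj)) t (stdVec α), Y] =
      fderiv ℝ (fun z => energy L ((extChartAt (velModel n k) u₀).symm z))
        (coordProlong φ (chartAt (Euc n) u₀.proj) t) Y := by
  set c := chartAt (Euc n) u₀.proj with hc
  set p := coordProlong φ c t with hpdef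
  have hφt := hφ.smooth.contMDiffAt (hφ.isOpen.mem_nhds ht)
  have hp : p.1 ∈ c.target := c.map_source hq
  have hpt : p ∈ (extChartAt (velModel n k) u₀).target := mem_extChartAt_vel_target.2 hp
  have hℓ := contDiffAt_coordLag hL hp
  have hP := (contDiffAt_coordProlong hφt hq).differentiableAt (by simp)
  have hnhds := (isOpen_extChartAt_target (I := velModel n k) u₀).mem_nhds hpt
  have hev : (fun z => energy L ((extChartAt (velModel n k) u₀).symm z)) =ᶠ[𝓝 p]
      fun z => fderiv ℝ (coordLag L c) z (0, z.2) - coordLag L c z := by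
    filter_upwards [hnhds] with z hz
    exact energy_extChartAt_symm hL (mem_extChartAt_vel_target.1 hz)
  rw [hev.fderiv_eq]
  refine sum_extDeriv_eq_fderiv_energy hℓ
    (fun α => (isSmooth_theta hL α).differentiableAt hpt) (fun α => ?_)
    (fun α => fderiv_coordProlong_fst hφt hq α) (fun i => ?_) Y
  · filter_upwards [hnhds] with z hz w
    exact inChart_theta hL α (mem_extChartAt_vel_target.1 hz) w
  · rw [← hφ.equation t ht c (chart_mem_atlas _ _) hq i]
    refine Finset.sum_congr rfl fun α _ => ?_
    have hddℓ : DifferentiableAt ℝ (fderiv ℝ (coordLag L c)) p :=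
      (hℓ.fderiv_right (m := ∞) (by simp)).differentiableAt (by simp)
    have h := (hddℓ.hasFDerivAt.comp t hP.hasFDerivAt).clm_apply
      (hasFDerivAt_const ((0, Pi.single α (stdVec i)) : Euc n × (Fin k → Euc n)) t)
    have h' := h.fderiv
    simp only [Function.comp_def] at h'
    rw [h']
    simp [c]

theorem mdifferentiableAt_energy (hL : ContMDiff (velModel n k) 𝓘(ℝ, ℝ) ∞ L) (u : T1 n k Q) :
    MDifferentiableAt (velModel n k) 𝓘(ℝ, ℝ) (energy L) u := by
  have hu := mem_extChartAt_target (I := velModel n k) u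
  have hℓ := contDiffAt_coordLag hL (mem_extChartAt_vel_target.1 hu)
  have h : ContDiffAt ℝ ∞ (fun z => energy L ((extChartAt (velModel n k) u).symm z))
      (extChartAt (velModel n k) u u) := by
    refine (((hℓ.fderiv_right (m := ∞) (by simp)).clm_apply
      ((contDiffAt_const (c := (0 : Euc n))).prodMk contDiffAt_snd)).sub hℓ).congr_of_eventuallyEq ?_
    filter_upwards [(isOpen_extChartAt_target (I := velModel n k) u).mem_nhds hu] with z hz
    exact energy_extChartAt_symm hL (mem_extChartAt_vel_target.1 hz)
  have h' := contMDiffAt_of_contDiffAt_inChart hu h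
  rw [extChartAt_to_inv] at h'
  exact h'.mdifferentiableAt (by simp)

/-- Hamiltonians `f^α` of a vector field that preserves the energy form a conservation law. -/
theorem isConservationLawOn_of_hamiltonian (hL : ContMDiff (velModel n k) 𝓘(ℝ, ℝ) ∞ L)
    {X : Π u : T1 n k Q, TVel u} (hE : ∀ u, dFun (energy L) u (X u) = 0)
    {W : Set (T1 n k Q)} (hW : IsOpen W) {f : Fin k → T1 n k Q → ℝ}
    (hf : ∀ α, ContMDiffOn (velModel n k) 𝓘(ℝ, ℝ) ∞ (f α) W)
    (hXf : ∀ α, ∀ u ∈ W, ∀ v : TVel u, omega L α u ![X u, v] = dFun (f α) u v) :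
    IsConservationLawOn L W f := by
  refine ⟨hf, fun U φ hφ hUW t ht => ?_⟩
  set u₀ : T1 n k Q := prolong φ t with hu₀
  set c := chartAt (Euc n) u₀.proj with hc
  set e := extChartAt (velModel n k) u₀ with he
  have hq : φ t ∈ c.source := mem_chart_source (Euc n) (φ t)
  have hφs : ∀ s ∈ U, ContMDiffAt (𝓡 k) (𝓡 n) ∞ φ s := fun s hs =>
    hφ.smooth.contMDiffAt (hφ.isOpen.mem_nhds hs)
  set P := coordProlong φ c with hPdef
  have hp : (P t).1 ∈ c.target := c.map_source hq
  have hpt : P t ∈ e.target := mem_extChartAt_vel_target.2 hp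
  have hev : ∀ᶠ s in 𝓝 t, e.symm (P s) = prolong φ s := by
    filter_upwards [hφ.isOpen.mem_nhds ht, (hφs t ht).continuousAt.preimage_mem_nhds
      (c.open_source.mem_nhds hq)] with s hs hs'
    exact extChartAt_symm_coordProlong (hφs s hs) hs'
  have huW : e.symm (P t) ∈ W := by
    rw [hev.self_of_nhds]; exact hUW t ht
  have hP := ((contDiffAt_coordProlong (hφs t ht) hq).differentiableAt (by simp)).hasFDerivAt
  have hfd : ∀ α, MDifferentiableAt (velModel n k) 𝓘(ℝ, ℝ) (f α) (e.symm (P t)) := fun α =>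
    ((hf α).contMDiffAt (hW.mem_nhds huW)).mdifferentiableAt (by simp)
  have hEd : MDifferentiableAt (velModel n k) 𝓘(ℝ, ℝ) (energy L) (e.symm (P t)) :=
    mdifferentiableAt_energy hL _
  set Xp := fieldInChart (I := velModel n k) X u₀ (P t) with hXp
  have hXs := mfderiv_symm_fieldInChart X hpt
  have hterm : ∀ α, fderiv ℝ (fun s => f α (prolong φ s)) t (stdVec α) =
      extDeriv (DForm.inChart (theta L α) u₀) (P t) ![fderiv ℝ P t (stdVec α), Xp] := by
    intro α
    have h1 : (fun s => f α (prolong φ s)) =ᶠ[𝓝 t] fun s => f α (e.symm (P s)) := by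
      filter_upwards [hev] with s hs
      rw [hs]
    have h2 : DifferentiableAt ℝ (fun z => f α (e.symm z)) (P t) :=
      ((hfd α).comp (P t) (mdifferentiableAt_extChartAt_symm_of_mem hpt)).differentiableAt
    have h3 := (h2.hasFDerivAt.comp t hP).fderiv
    simp only [Function.comp_def] at h3
    rw [h1.fderiv_eq, h3, ContinuousLinearMap.comp_apply, ← dFun_mfderiv_symm hp (hfd α),
      ← hXf α _ huW, omega_swap]
    have h4 := omega_mfderiv_symm hL α hpt ![fderiv ℝ P t (stdVec α), Xp]
    rw [← neg_neg (extDeriv _ _ _), ← h4]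
    congr 2
    funext i
    refine Fin.cases rfl (fun j => ?_) i
    rw [Subsingleton.elim j 0]
    exact hXs.symm
  rw [Finset.sum_congr rfl fun α _ => hterm α]
  have hsum := hφ.sum_omega hL ht (u₀ := u₀) hq Xp
  rw [← dFun_mfderiv_symm hp hEd, hXs, hE, Finset.sum_neg_distrib, neg_eq_zero] at hsum
  exact hsum

end Noether

end KSymplectic

theorem theorem3 (n k : ℕ) (Q : Type*) [TopologicalSpace Q] [ChartedSpace (Euc n) Q]
    [IsManifold (𝓡 n) ∞ Q] (L : T1 n k Q → ℝ)
    (hL : ContMDiff (velModel n k) 𝓘(ℝ, ℝ) ∞ L)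
    (X : Π u : T1 n k Q, TVel u) (hX : IsCartanSymmetry L X) :
    (∀ u : T1 n k Q, ∃ (W : Set (T1 n k Q)) (g : Fin k → T1 n k Q → ℝ),
      u ∈ W ∧ IsLiePotentialOn L X W g) ∧
    ∀ (W : Set (T1 n k Q)) (g : Fin k → T1 n k Q → ℝ), IsLiePotentialOn L X W g →
      ∀ f : Fin k → T1 n k Q → ℝ, (∀ α u, f α u = theta L α u (fun _ => X u) - g α u) →
        IsConservationLawOn L W f ∧
        (∀ α, ∀ u ∈ W, ∀ v : TVel u, omega L α u ![X u, v] = dFun (f α) u v) ∧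
        ∀ ξ : Fin k → Π u : T1 n k Q, TVel u, IsLagrangianSopde L ξ →
          ∀ u ∈ W, ∑ α, dFun (f α) u (ξ α u) = 0 := by
  refine ⟨exists_isLiePotentialOn hL hX, fun W g hg f hf => ?_⟩
  have hXf : ∀ α, ∀ u ∈ W, ∀ v : TVel u, omega L α u ![X u, v] = dFun (f α) u v :=
    fun α u hu v => omega_eq_dFun hL hX.smooth hg hf α hu v
  refine ⟨isConservationLawOn_of_hamiltonian hL hX.energy hg.isOpen
    (contMDiffOn_conserved hL hX.smooth hg hf) hXf, hXf, fun ξ hξ u hu => ?_⟩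
  have h := hξ.equation u (X u)
  rw [hX.energy u] at h
  rw [← neg_eq_zero, ← h, ← Finset.sum_neg_distrib]
  exact Finset.sum_congr rfl fun α _ => by rw [← hXf α u hu, ← omega_swap]
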